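/- **Notation.** For $n\ge 1$ and positive integers $p\mid r$, let $G(r,p,n)$ be the group of all $n\times n$ complex monomial matrices whose nonzero entries are $r$-th roots of unity and such that the product of the nonzero entries is an $\frac rp$-th root of unity; it acts on $V=\mathbb C^n$. For each $k\geq 1$ fix a primitive $k$-th root of unity $\xi_k\in\mathbb C$. For a coset $\gamma G$ and $\zeta\in\mathbb C^\times$ let $\mathcal S_\zeta^V(\gamma G)$ be the set of eigenspaces $V(x,\zeta)=\{v\in V: xv=\zeta v\}$, $x\in\gamma G$, partially ordered by the reverse of inclusion. For a poset $P$, let $\hat P$ be $P$ with a new least element $\hat 0$ and a new greatest element $\hat 1$ adjoined. Let $\widetilde{\mathcal S}_\zeta^V(\gamma G)$ be obtained from $\mathcal S_\zeta^V(\gamma G)$ by deleting its greatest element and, if it exists, its least element. For a group $H$, an $H$-prepartition of $[n]=\{1,\dots,n\}$ is a triple $(I,\pi,\lambda)$ with $I\subseteq[n]$ (the zero block), $\pi$ a partition of $[n]\setminus I$ into nonempty (nonzero) blocks, and $\lambda:[n]\setminus I\to H$. Two prepartitions are equivalent if they have the same $I$ and $\pi$ and, on each nonzero block, their labellings differ by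 right multiplication by an element of $H$; the classes are the $H$-partitions. The Dowling lattice $Q_n(H)$ is the set of $H$-partitions with the partial order generated by merges: either a nonzero block is absorbed into the zero block, or two nonzero blocks $(B,\lambda|_B)$, $(C,\lambda|_C)$ are replaced by the single block $B\cup C$ labelled by $\lambda|_B$ on $B$ and by $\lambda|_C\cdot h$ on $C$, for some $h\in H$. Its least element $\hat0$ has $I=\emptyset$ and all blocks singletons. Put $Q_n(r)=Q_n(\mathbb Z/r\mathbb Z)$. The following are subposets of $Q_n(r)$ (for $k\mid r$, $k\mid d$, $J\subseteq\{0,\dots,n\}$), each of them together with the element $\hat 0$ of $Q_n(r)$: * $Q_n(r,J)$: the elements with $|I|\notin J$; * $Q_n(r,d,k)$: the elements such that every nonzero block $B$ has size divisible by $d$ and $|\{a\in B:\lambda(a)\equiv j \pmod k\}|$ is independent of $j$; * $Q_n(r,d,k,J)$: the elements of $Q_n(r,d,k)$ described in the previous item that also satisfy $|I|\notin J$. $\Pi_n$ is the lattice of partitions of $[n]$, ordered by refinement, with the partition into singletons as least element. **Proposition.** Let $r,p,n,e,m$ be positive integers with $p\mid r$, $e\mid p$ and $n>1$. Let $G=G(r,p,n)$,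 let $\gamma=\operatorname{diag}(\xi_{\frac{er}{p}},1,\dots,1)$, let $\zeta$ be a primitive $m$-th root of unity, and let $d=\frac{m}{\gcd(m,r)}$. Then $\mathcal S_\zeta^V(\gamma G)$ has a greatest element, and: 1. If $n\equiv 0\pmod d$ and $(\zeta^n\xi_{\frac{er}{p}}^{-1})^{\frac rp}\ne 1$, then $\widehat{\widetilde{\mathcal S}_\zeta^V(\gamma G)}\cong Q_n(dr,d,d,\{0\})$. 2. If $d=1$, $r=p\neq 1$ and $\zeta^n=\xi_e$, then $\widehat{\widetilde{\mathcal S}_\zeta^V(\gamma G)}\cong Q_n(r,\{1\})$. 3. If $d=1$ and $r=p=1$, then $m=1$ and $\widehat{\widetilde{\mathcal S}_\zeta^V(\gamma G)}\cong Q_{n-1}(1)\cong\Pi_n$. 4. In all other cases, except the case $n=2$, $r=1$, $m=2$, we have $\widehat{\widetilde{\mathcal S}_\zeta^V(\gamma G)}\cong Q_n(dr,d,d)$. -/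

import Mathlib

/-! ### The groups `G(r, p, n)` and their cosets -/

/-- The `n × n` monomial matrix sending the basis vector `e_j` to `θ (σ j) • e_(σ j)`. -/
def monomialMatrix {n : ℕ} (θ : Fin n → ℂˣ) (σ : Equiv.Perm (Fin n)) :
    Matrix (Fin n) (Fin n) ℂ :=
  Matrix.of fun i j => if i = σ j then (θ i : ℂ) else 0

theorem monomialMatrix_mul {n : ℕ} (θ θ' : Fin n → ℂˣ) (σ σ' : Equiv.Perm (Fin n)) :
    monomialMatrix θ σ * monomialMatrix θ' σ'
      = monomialMatrix (fun i => θ i * θ' (σ.symm i)) (σ * σ') := by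
  ext i j
  simp only [monomialMatrix, Matrix.mul_apply, Matrix.of_apply]
  rw [Finset.sum_eq_single (σ' j)]
  · by_cases h : i = σ (σ' j)
    · simp [h]
    · simp [h]
  · intro b _ hb
    simp [hb]
  · simp

theorem monomialMatrix_one {n : ℕ} :
    monomialMatrix (fun _ : Fin n => (1 : ℂˣ)) 1 = 1 := by
  ext i j
  by_cases h : i = j <;> simp [monomialMatrix, Matrix.one_apply, h]

/-- The imprimitive reflection group `G(r, p, n)`: the monomial matrices whose nonzero entries
are `r`-th roots of unity and the product of whose nonzero entries is an `(r/p)`-th root of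
unity. -/
def imprimitiveGroup (r p n : ℕ) : Subgroup (GL (Fin n) ℂ) where
  carrier := {g | ∃ (θ : Fin n → ℂˣ) (σ : Equiv.Perm (Fin n)),
    (∀ i, θ i ^ r = 1) ∧ (∏ i, θ i) ^ (r / p) = 1 ∧
      (g : Matrix (Fin n) (Fin n) ℂ) = monomialMatrix θ σ}
  one_mem' := ⟨fun _ => 1, 1, by simp, by simp, by simp [monomialMatrix_one]⟩
  mul_mem' := by
    rintro g g' ⟨θ, σ, h1, h2, h3⟩ ⟨θ', σ', h1', h2', h3'⟩
    refine ⟨fun i => θ i * θ' (σ.symm i), σ * σ', fun i => ?_, ?_, ?_⟩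
    · rw [mul_pow, h1, h1', one_mul]
    · rw [Finset.prod_mul_distrib, Equiv.prod_comp σ.symm θ', mul_pow, h2, h2', one_mul]
    · rw [Units.val_mul, h3, h3', monomialMatrix_mul]
  inv_mem' := by
    rintro g ⟨θ, σ, h1, h2, h3⟩
    refine ⟨fun i => (θ (σ i))⁻¹, σ⁻¹, fun i => ?_, ?_, ?_⟩
    · rw [inv_pow, h1, inv_one]
    · rw [Finset.prod_inv_distrib, Equiv.prod_comp σ θ, inv_pow, h2, inv_one]
    · rw [Matrix.coe_units_inv]
      refine Matrix.inv_eq_right_inv ?_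
      rw [h3, monomialMatrix_mul]
      simp [monomialMatrix_one]

/-- The diagonal matrix `diag(ξ, 1, …, 1)`. -/
def diagFirst (n : ℕ) (ξ : ℂ) : Matrix (Fin n) (Fin n) ℂ :=
  Matrix.diagonal fun i => if (i : ℕ) = 0 then ξ else 1

/-- The coset `γ G`, as a set of matrices. -/
def matrixCoset {n : ℕ} (γ : Matrix (Fin n) (Fin n) ℂ) (G : Subgroup (GL (Fin n) ℂ)) :
    Set (Matrix (Fin n) (Fin n) ℂ) :=
  {x | ∃ g ∈ G, x = γ * (g : Matrix (Fin n) (Fin n) ℂ)}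

/-! ### The posets of eigenspaces -/

/-- The poset `S_ζ^V(X)` of `ζ`-eigenspaces in `V = ℂⁿ` of the elements of `X`, ordered by the
reverse of inclusion. -/
abbrev EigenspacePoset {n : ℕ} (X : Set (Matrix (Fin n) (Fin n) ℂ)) (ζ : ℂ) : Type :=
  {W : Submodule ℂ (Fin n → ℂ) //
    ∃ x ∈ X, W = Module.End.eigenspace (Matrix.toLin' x) ζ}ᵒᵈ

/-- The poset obtained from `P` by deleting the greatest element and the least element, each
if it exists. -/
abbrev ProperPart (P : Type*) [PartialOrder P] : Type _ :=
  {x : P // ¬ IsTop x ∧ ¬ IsBot x}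

/-- The poset obtained from `P` by adjoining a new least element and a new greatest element. -/
abbrev AdjoinBounds (P : Type*) [PartialOrder P] : Type _ := WithBot (WithTop P)

/-! ### Dowling lattices -/

/-- A `G`-prepartition of `[n]`: a zero block `I`, a partition of the complement of `I` into
nonempty nonzero blocks, and a labelling by elements of `G`. The labels of elements of `I` carry
no information: the equivalence below ignores them. -/
structure GPrepartition (G : Type*) (n : ℕ) where
  /-- the zero block -/
  zeroBlock : Finset (Fin n)
  /-- the partition of the complement of the zero block -/
  partition : Finpartition zeroBlockᶜ
  /-- the labels -/
  label : Fin n → G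

namespace GPrepartition

variable {G : Type*} [Group G] {n : ℕ}

/-- Two prepartitions are equivalent if they have the same zero block and the same underlying
nonzero blocks, and on each nonzero block the labellings differ by right multiplication by an
element of `G`. -/
def Equivalent (P Q : GPrepartition G n) : Prop :=
  P.zeroBlock = Q.zeroBlock ∧ P.partition.parts = Q.partition.parts ∧
    ∀ B ∈ P.partition.parts, ∃ g : G, ∀ a ∈ B, Q.label a = P.label a * g

/-- `Q` is obtained from `P` by merging the zero block with a nonzero block. -/
def ZeroMerge (P Q : GPrepartition G n) : Prop :=
  ∃ B ∈ P.partition.parts,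
    Q.zeroBlock = P.zeroBlock ∪ B ∧
    Q.partition.parts = P.partition.parts.erase B ∧
    ∀ a, a ∉ Q.zeroBlock → Q.label a = P.label a

/-- `Q` is obtained from `P` by replacing two distinct nonzero blocks `B` and `C` by
`B ∪ C · g` for some `g` in `G`. -/
def NonzeroMerge (P Q : GPrepartition G n) : Prop :=
  ∃ B ∈ P.partition.parts, ∃ C ∈ P.partition.parts, B ≠ C ∧
    Q.zeroBlock = P.zeroBlock ∧
    Q.partition.parts = insert (B ∪ C) ((P.partition.parts.erase B).erase C) ∧
    ∃ g : G, (∀ a ∈ C, Q.label a = P.label a * g) ∧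
      ∀ a, a ∉ Q.zeroBlock → a ∉ C → Q.label a = P.label a

variable (G n) in
/-- Equivalence of prepartitions. -/
instance setoid : Setoid (GPrepartition G n) where
  r := Equivalent
  iseqv :=
    { refl := fun P => ⟨rfl, rfl, fun _ _ => ⟨1, fun a _ => (mul_one _).symm⟩⟩
      symm := by
        rintro P Q ⟨h1, h2, h3⟩
        refine ⟨h1.symm, h2.symm, fun B hB => ?_⟩
        obtain ⟨g, hg⟩ := h3 B (h2 ▸ hB)
        exact ⟨g⁻¹, fun a ha => by rw [hg a ha, mul_inv_cancel_right]⟩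
      trans := by
        rintro P Q R ⟨h1, h2, h3⟩ ⟨h1', h2', h3'⟩
        refine ⟨h1.trans h1', h2.trans h2', fun B hB => ?_⟩
        obtain ⟨g, hg⟩ := h3 B hB
        obtain ⟨g', hg'⟩ := h3' B (h2 ▸ hB)
        exact ⟨g * g', fun a ha => by rw [hg' a ha, hg a ha, mul_assoc]⟩ }

end GPrepartition

/-- The underlying set of the Dowling lattice `Q_n(G)`: the `G`-partitions of `[n]`. -/
def DowlingLattice (G : Type*) [Group G] (n : ℕ) : Type _ :=
  Quotient (GPrepartition.setoid G n)

namespace DowlingLattice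

variable {G : Type*} [Group G] {n : ℕ}

/-- The `G`-partition represented by a `G`-prepartition. -/
def mk (P : GPrepartition G n) : DowlingLattice G n := Quotient.mk _ P

/-- The covering relation: `y` is obtained from `x` by merging two `G`-blocks. -/
def Covers (x y : DowlingLattice G n) : Prop :=
  ∃ P Q : GPrepartition G n, mk P = x ∧ mk Q = y ∧ (P.ZeroMerge Q ∨ P.NonzeroMerge Q)

/-- The number of nonzero blocks. -/
def numBlocks (x : DowlingLattice G n) : ℕ :=
  Quotient.lift (s := GPrepartition.setoid G n) (fun P => P.partition.parts.card)
    (fun P Q (h : P.Equivalent Q) => congrArg Finset.card h.2.1) x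

theorem Covers.numBlocks_lt {x y : DowlingLattice G n} (h : Covers x y) :
    y.numBlocks < x.numBlocks := by
  obtain ⟨P, Q, rfl, rfl, h⟩ := h
  change Q.partition.parts.card < P.partition.parts.card
  rcases h with ⟨B, hB, -, h, -⟩ | ⟨B, hB, C, hC, hne, -, h, -⟩
  · rw [h]
    exact Finset.card_erase_lt_of_mem hB
  · rw [h]
    have hC' : C ∈ P.partition.parts.erase B := Finset.mem_erase.2 ⟨hne.symm, hC⟩
    have e1 := Finset.card_erase_add_one hC'
    have e2 := Finset.card_erase_add_one hB
    have e3 := Finset.card_insert_le (B ∪ C) ((P.partition.parts.erase B).erase C)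
    omega

theorem eq_or_numBlocks_lt {x y : DowlingLattice G n} (h : Relation.ReflTransGen Covers x y) :
    x = y ∨ y.numBlocks < x.numBlocks := by
  induction h with
  | refl => exact Or.inl rfl
  | tail _ h ih =>
    rcases ih with rfl | ih
    · exact Or.inr h.numBlocks_lt
    · exact Or.inr (h.numBlocks_lt.trans ih)

/-- The order of the Dowling lattice: `x ≤ y` if `y` is obtained from `x` by finitely many
merges. -/
instance : PartialOrder (DowlingLattice G n) where
  le := Relation.ReflTransGen Covers
  le_refl _ := Relation.ReflTransGen.refl
  le_trans _ _ _ h h' := h.trans h'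
  le_antisymm x y h h' := by
    rcases eq_or_numBlocks_lt h with e | e
    · exact e
    · rcases eq_or_numBlocks_lt h' with e' | e'
      · exact e'.symm
      · omega

/-- The minimum element: empty zero block, and all nonzero blocks singletons. -/
def zeroHat : DowlingLattice G n := mk ⟨∅, ⊥, fun _ => 1⟩

end DowlingLattice

/-- The Dowling lattice `Q_n(r)` of the cyclic group of order `r`, identified with `ℤ/rℤ`. -/
abbrev QDowling (n r : ℕ) : Type := DowlingLattice (Multiplicative (ZMod r)) n

namespace GPrepartition

/-- All nonzero blocks have size divisible by `d`. -/
def IsDivisible {G : Type*} {n : ℕ} (d : ℕ) (P : GPrepartition G n) : Prop :=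
  ∀ B ∈ P.partition.parts, d ∣ B.card

/-- In each nonzero block, all residue classes modulo `k` occur equally often as labels. -/
def IsEvenlyColoured {n r : ℕ} (k : ℕ) (P : GPrepartition (Multiplicative (ZMod r)) n) : Prop :=
  ∀ B ∈ P.partition.parts, ∀ i j : ℕ,
    (B.filter fun a => (Multiplicative.toAdd (P.label a)).val ≡ i [MOD k]).card =
      (B.filter fun a => (Multiplicative.toAdd (P.label a)).val ≡ j [MOD k]).card

end GPrepartition

/-- `Q_n(r, J)`: the elements of `Q_n(r)` whose zero block has size outside `J`, together with
the minimum element. -/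
abbrev QDowlingAvoid (n r : ℕ) (J : Set ℕ) : Type :=
  {x : QDowling n r // x = DowlingLattice.zeroHat ∨
    ∃ P, DowlingLattice.mk P = x ∧ P.zeroBlock.card ∉ J}

/-- `Q_n(r, d, k)` (for `k ∣ r` and `k ∣ d`): the `k`-evenly coloured elements of `Q_n(r)` with
nonzero blocks of size divisible by `d`, together with the minimum element. -/
abbrev QDowlingEven (n r d k : ℕ) : Type :=
  {x : QDowling n r // x = DowlingLattice.zeroHat ∨
    ∃ P, DowlingLattice.mk P = x ∧ P.IsDivisible d ∧ P.IsEvenlyColoured k}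

/-- `Q_n(r, d, k, J)` (for `k ∣ r` and `k ∣ d`): the elements of `Q_n(r, d, k)` whose zero block
has size outside `J`, together with the minimum element. -/
abbrev QDowlingEvenAvoid (n r d k : ℕ) (J : Set ℕ) : Type :=
  {x : QDowling n r // x = DowlingLattice.zeroHat ∨
    ∃ P, DowlingLattice.mk P = x ∧ P.IsDivisible d ∧ P.IsEvenlyColoured k ∧
      P.zeroBlock.card ∉ J}

/-- The lattice `Π_n` of partitions of `[n]`, ordered by refinement (the partition into
singletons is the minimum). -/
abbrev PartitionLattice (n : ℕ) : Type := Finpartition (Finset.univ : Finset (Fin n))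

/-! ### Refinement of prepartitions and the order of the Dowling lattice. -/

namespace GPrepartition

variable {G : Type*} {n : ℕ}

/-! Let `x` be a monomial matrix with underlying permutation `σ` and entries `r`-th roots of unity.
On a cycle of `σ`, one coordinate of a `ζ`-eigenvector determines the others, so the eigenspace
either vanishes on the cycle or restricts to a line there. The line has a spanning vector whose
values are `d * r`-th roots of unity. The eigenspace is thus `P.subspace χ` for a prepartition `P`:
the zero block `I` collects the cycles of the first kind, the nonzero blocks are the other cycles,
and a faithful character `χ` of `ℤ/drℤ` turns labels into values. Along a cycle the `r`-th powers of
the values are multiplied by `(ζ ^ r)⁻¹`, a primitive `d`-th root of unity, so the labels are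
equidistributed modulo `d` (`exists_subspace_eq_eigenspace`). Since `P ↦ P.subspace χ` embeds the
Dowling lattice into the subspaces under reverse inclusion (`exists_orderEmbedding`), it remains to
find which evenly coloured `P` occur.

Membership in the coset constrains only the product `t` of the entries: `t ^ (r / p)` is prescribed.
A cycle outside `I` has product `ζ` to its length, a cycle inside `I` any other product. Hence `I =
∅` forces `t = ζ ^ n`, which may be forbidden (case 1). If `t` is forced to be `ζ ^ n`, a zero block
of size one would carry the entry `ζ` and so not be a zero block (case 2). For the symmetric group
the all-ones vector is fixed, so `I = ∅` always, and the labels are trivial (case 3). Otherwise one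
cycle on `I`, or two if `t = ζ ^ n`, realises every `P` (`exists_mem_coset`).

Finally, deleting a least element must lose nothing, so a least eigenspace has to correspond to
`zeroHat` or to be the only one. Eigenspaces are permuted by `G(r, 1, n)`, so a least one is
invariant; this leaves no proper nonzero candidate except for `n = 2`, `r = 1`, `m = 2`
(`not_forall_eigenspace_le`). -/

theorem notMem_zeroBlock_of_mem {P : GPrepartition G n} {B : Finset (Fin n)} {a : Fin n}
    (hB : B ∈ P.partition.parts) (ha : a ∈ B) : a ∉ P.zeroBlock :=
  Finset.mem_compl.1 (P.partition.subset hB ha)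

theorem exists_part_of_notMem {P : GPrepartition G n} {a : Fin n} (ha : a ∉ P.zeroBlock) :
    ∃ B ∈ P.partition.parts, a ∈ B :=
  P.partition.exists_mem (Finset.mem_compl.2 ha)

theorem exists_zeroMerge (P : GPrepartition G n) {B : Finset (Fin n)}
    (hB : B ∈ P.partition.parts) :
    ∃ P' : GPrepartition G n, P'.zeroBlock = P.zeroBlock ∪ B ∧
      P'.partition.parts = P.partition.parts.erase B ∧ P'.label = P.label := by
  refine ⟨⟨P.zeroBlock ∪ B, Finpartition.ofExistsUnique (P.partition.parts.erase B) ?_ ?_ ?_,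
    P.label⟩, rfl, rfl, rfl⟩
  · intro C hC a ha
    obtain ⟨hne, hC⟩ := Finset.mem_erase.1 hC
    rw [Finset.mem_compl, Finset.mem_union, not_or]
    exact ⟨notMem_zeroBlock_of_mem hC ha,
      fun haB => hne (P.partition.eq_of_mem_parts hC hB ha haB)⟩
  · intro a ha
    rw [Finset.mem_compl, Finset.mem_union, not_or] at ha
    obtain ⟨C, hC, haC⟩ := exists_part_of_notMem ha.1
    refine ⟨C, ⟨Finset.mem_erase.2 ⟨fun h => ha.2 (h ▸ haC), hC⟩, haC⟩, ?_⟩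
    rintro D ⟨hD, haD⟩
    exact P.partition.eq_of_mem_parts (Finset.mem_of_mem_erase hD) hC haD haC
  · exact fun h => P.partition.bot_notMem (Finset.mem_of_mem_erase h)

variable [Group G]

/-- Every block of `P` is contained in a block of `Q`, compatibly with the zero blocks and the
labels. -/
def Refines (P Q : GPrepartition G n) : Prop :=
  P.zeroBlock ⊆ Q.zeroBlock ∧ ∀ B ∈ P.partition.parts, B ⊆ Q.zeroBlock ∨
    ∃ C ∈ Q.partition.parts, B ⊆ C ∧ ∃ g : G, ∀ a ∈ B, Q.label a = P.label a * g

theorem Equivalent.refines {P Q : GPrepartition G n} (h : P.Equivalent Q) : P.Refines Q := by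
  obtain ⟨h1, h2, h3⟩ := h
  exact ⟨h1.subset, fun B hB => Or.inr ⟨B, h2 ▸ hB, subset_rfl, h3 B hB⟩⟩

theorem Refines.trans {P Q R : GPrepartition G n} (h : P.Refines Q) (h' : Q.Refines R) :
    P.Refines R := by
  refine ⟨h.1.trans h'.1, fun B hB => ?_⟩
  rcases h.2 B hB with hB' | ⟨C, hC, hBC, g, hg⟩
  · exact Or.inl (hB'.trans h'.1)
  rcases h'.2 C hC with hC' | ⟨D, hD, hCD, g', hg'⟩
  · exact Or.inl (hBC.trans hC')
  · exact Or.inr ⟨D, hD, hBC.trans hCD, g * g', fun a ha => by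
      rw [hg' a (hBC ha), hg a ha, mul_assoc]⟩

theorem ZeroMerge.refines {P Q : GPrepartition G n} (h : P.ZeroMerge Q) : P.Refines Q := by
  obtain ⟨B, hB, h1, h2, h3⟩ := h
  refine ⟨h1 ▸ Finset.subset_union_left, fun C hC => ?_⟩
  by_cases hCB : C = B
  · exact Or.inl (by rw [h1, hCB]; exact Finset.subset_union_right)
  · have hC' : C ∈ Q.partition.parts := h2 ▸ Finset.mem_erase.2 ⟨hCB, hC⟩
    exact Or.inr ⟨C, hC', subset_rfl, 1, fun a ha => by
      rw [mul_one, h3 a (notMem_zeroBlock_of_mem hC' ha)]⟩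

theorem NonzeroMerge.refines {P Q : GPrepartition G n} (h : P.NonzeroMerge Q) :
    P.Refines Q := by
  obtain ⟨B, hB, C, hC, hne, h1, h2, g, hg, h3⟩ := h
  have hmem : B ∪ C ∈ Q.partition.parts := h2 ▸ Finset.mem_insert_self _ _
  have hlab : ∀ E ∈ P.partition.parts, E ≠ C → ∀ a ∈ E, Q.label a = P.label a * 1 := by
    intro E hE hEC a ha
    rw [mul_one]
    exact h3 a (h1 ▸ notMem_zeroBlock_of_mem hE ha)
      fun haC => hEC (P.partition.eq_of_mem_parts hE hC ha haC)
  refine ⟨h1.symm.subset, fun E hE => Or.inr ?_⟩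
  by_cases hEC : E = C
  · exact ⟨_, hmem, hEC ▸ Finset.subset_union_right, g, fun a ha => hg a (hEC ▸ ha)⟩
  by_cases hEB : E = B
  · exact ⟨_, hmem, hEB ▸ Finset.subset_union_left, 1, hlab E hE hEC⟩
  · refine ⟨E, ?_, subset_rfl, 1, hlab E hE hEC⟩
    rw [h2]
    exact Finset.mem_insert_of_mem (Finset.mem_erase.2 ⟨hEC, Finset.mem_erase.2 ⟨hEB, hE⟩⟩)

theorem exists_nonzeroMerge (P : GPrepartition G n) {B C : Finset (Fin n)}
    (hB : B ∈ P.partition.parts) (hC : C ∈ P.partition.parts) (g : G) :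
    ∃ P' : GPrepartition G n, P'.zeroBlock = P.zeroBlock ∧
      P'.partition.parts = insert (B ∪ C) ((P.partition.parts.erase B).erase C) ∧
      (∀ a ∈ C, P'.label a = P.label a * g) ∧ ∀ a ∉ C, P'.label a = P.label a := by
  refine ⟨⟨P.zeroBlock, Finpartition.ofExistsUnique
    (insert (B ∪ C) ((P.partition.parts.erase B).erase C)) ?_ ?_ ?_,
    fun a => if a ∈ C then P.label a * g else P.label a⟩, rfl, rfl,
    fun a ha => if_pos ha, fun a ha => if_neg ha⟩
  · intro E hE
    rcases Finset.mem_insert.1 hE with rfl | hE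
    · exact Finset.union_subset (P.partition.subset hB) (P.partition.subset hC)
    · exact P.partition.subset (Finset.mem_of_mem_erase (Finset.mem_of_mem_erase hE))
  · intro a ha
    obtain ⟨E, hE, haE⟩ := P.partition.exists_mem ha
    by_cases hEBC : E = B ∨ E = C
    · have haBC : a ∈ B ∪ C := by
        rcases hEBC with rfl | rfl <;> simp [haE]
      refine ⟨B ∪ C, ⟨Finset.mem_insert_self _ _, haBC⟩, ?_⟩
      rintro D ⟨hD, haD⟩
      rcases Finset.mem_insert.1 hD with h | hD
      · exact h
      · simp only [Finset.mem_erase] at hD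
        have := P.partition.eq_of_mem_parts hD.2.2 hE haD haE
        subst this
        tauto
    · rw [not_or] at hEBC
      refine ⟨E, ⟨Finset.mem_insert_of_mem (Finset.mem_erase.2 ⟨hEBC.2,
        Finset.mem_erase.2 ⟨hEBC.1, hE⟩⟩), haE⟩, ?_⟩
      rintro D ⟨hD, haD⟩
      rcases Finset.mem_insert.1 hD with rfl | hD
      · rcases Finset.mem_union.1 haD with h | h
        · exact absurd (P.partition.eq_of_mem_parts hE hB haE h) hEBC.1
        · exact absurd (P.partition.eq_of_mem_parts hE hC haE h) hEBC.2
      · exact P.partition.eq_of_mem_parts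
          (Finset.mem_of_mem_erase (Finset.mem_of_mem_erase hD)) hE haD haE
  · intro h
    rcases Finset.mem_insert.1 h with h | h
    · have := P.partition.nonempty_of_mem_parts hB
      rw [(Finset.union_eq_empty.1 h.symm).1] at this
      exact Finset.not_nonempty_empty this
    · exact P.partition.bot_notMem (Finset.mem_of_mem_erase (Finset.mem_of_mem_erase h))

/-- A refinement that cannot be improved by a merge is an equivalence. -/
theorem Refines.equivalent {P Q : GPrepartition G n} (h : P.Refines Q)
    (h0 : ∀ B ∈ P.partition.parts, ¬ B ⊆ Q.zeroBlock)
    (h1 : ∀ B ∈ P.partition.parts, ∀ C ∈ P.partition.parts, ∀ E ∈ Q.partition.parts,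
      B ⊆ E → C ⊆ E → B = C) : P.Equivalent Q := by
  have hz : P.zeroBlock = Q.zeroBlock := by
    refine h.1.antisymm fun a ha => ?_
    by_contra hP
    obtain ⟨B, hB, haB⟩ := exists_part_of_notMem hP
    rcases h.2 B hB with h2 | ⟨C, hC, hBC, -⟩
    · exact h0 B hB h2
    · exact notMem_zeroBlock_of_mem hC (hBC haB) ha
  -- Any further point of `C` lies in a block of `P` that is also contained in `C`, and `h1`
  -- identifies that block with `B`.
  have key : ∀ B ∈ P.partition.parts, ∀ C ∈ Q.partition.parts, B ⊆ C → B = C := by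
    intro B hB C hC hBC
    refine hBC.antisymm fun a ha => ?_
    obtain ⟨B', hB', haB'⟩ :=
      exists_part_of_notMem (P := P) (hz ▸ notMem_zeroBlock_of_mem hC ha)
    rcases h.2 B' hB' with h2 | ⟨C', hC', hBC', -⟩
    · exact absurd h2 (h0 B' hB')
    · have := Q.partition.eq_of_mem_parts hC' hC (hBC' haB') ha
      rw [h1 B hB B' hB' C hC hBC (this ▸ hBC')]
      exact haB'
  refine ⟨hz, Finset.Subset.antisymm (fun B hB => ?_) fun C hC => ?_, fun B hB => ?_⟩
  · rcases h.2 B hB with h2 | ⟨C, hC, hBC, -⟩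
    · exact absurd h2 (h0 B hB)
    · exact key B hB C hC hBC ▸ hC
  · obtain ⟨a, ha⟩ := Q.partition.nonempty_of_mem_parts hC
    obtain ⟨B, hB, haB⟩ := exists_part_of_notMem (P := P) (hz ▸ notMem_zeroBlock_of_mem hC ha)
    rcases h.2 B hB with h2 | ⟨C', hC', hBC, -⟩
    · exact absurd h2 (h0 B hB)
    · have := Q.partition.eq_of_mem_parts hC' hC (hBC haB) ha
      subst this
      exact key B hB C' hC hBC ▸ hB
  · rcases h.2 B hB with h2 | ⟨C, hC, hBC, hg⟩
    · exact absurd h2 (h0 B hB)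
    · exact hg

end GPrepartition

namespace DowlingLattice

open GPrepartition

variable {G : Type*} [Group G] {n : ℕ}

theorem mk_eq_mk {P Q : GPrepartition G n} : mk P = mk Q ↔ P.Equivalent Q :=
  ⟨fun h => Quotient.exact h, fun h => Quotient.sound h⟩

theorem mk_surjective (x : DowlingLattice G n) : ∃ P, mk P = x := Quotient.exists_rep x

theorem Covers.refines {x y : DowlingLattice G n} (h : Covers x y)
    {P Q : GPrepartition G n} (hP : mk P = x) (hQ : mk Q = y) : P.Refines Q := by
  obtain ⟨P', Q', rfl, rfl, h⟩ := h
  have h' : P'.Refines Q' := h.elim ZeroMerge.refines NonzeroMerge.refines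
  exact ((mk_eq_mk.1 hP).refines.trans h').trans (mk_eq_mk.1 hQ.symm).refines

theorem refines_of_mk_le {P Q : GPrepartition G n} (h : mk P ≤ mk Q) : P.Refines Q := by
  have key : ∀ {x y : DowlingLattice G n}, Relation.ReflTransGen Covers x y →
      ∀ {P Q : GPrepartition G n}, mk P = x → mk Q = y → P.Refines Q := by
    intro x y hxy
    induction hxy with
    | refl => exact fun hP hQ => (mk_eq_mk.1 (hP.trans hQ.symm)).refines
    | @tail y z _ hyz ih =>
      intro P Q hP hQ
      obtain ⟨R, hR⟩ := mk_surjective y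
      exact (ih hP hR).trans (hyz.refines hR hQ)
  exact key h rfl rfl

/-- Induction on the number of blocks of `P`. A block inside the zero block of `Q` can be absorbed,
and two blocks inside one block of `Q` can be merged, without losing the refinement. If neither is
possible, `P` and `Q` are equivalent. -/
theorem mk_le_of_refines {P Q : GPrepartition G n} (h : P.Refines Q) : mk P ≤ mk Q := by
  induction hk : P.partition.parts.card using Nat.strong_induction_on generalizing P with
  | _ k ih =>
  have step : ∀ P' : GPrepartition G n, P.ZeroMerge P' ∨ P.NonzeroMerge P' → P'.Refines Q →
      mk P ≤ mk Q := by
    intro P' hP' hPQ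
    have hc : Covers (mk P) (mk P') := ⟨P, P', rfl, rfl, hP'⟩
    have hlt := hc.numBlocks_lt
    exact Relation.ReflTransGen.head hc (ih _ (hk ▸ hlt) hPQ rfl)
  by_cases h0 : ∃ B ∈ P.partition.parts, B ⊆ Q.zeroBlock
  · obtain ⟨B, hB, hBQ⟩ := h0
    obtain ⟨P', e1, e2, e3⟩ := P.exists_zeroMerge hB
    refine step P' (Or.inl ⟨B, hB, e1, e2, fun a _ => by rw [e3]⟩)
      ⟨e1 ▸ Finset.union_subset h.1 hBQ, fun C hC => ?_⟩
    rw [e3]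
    exact h.2 C (Finset.mem_of_mem_erase (e2 ▸ hC))
  push Not at h0
  by_cases h1 : ∃ B ∈ P.partition.parts, ∃ C ∈ P.partition.parts,
      ∃ E ∈ Q.partition.parts, B ⊆ E ∧ C ⊆ E ∧ B ≠ C
  · obtain ⟨B, hB, C, hC, E, hE, hBE, hCE, hne⟩ := h1
    have hlab : ∀ B ∈ P.partition.parts, B ⊆ E →
        ∃ g : G, ∀ a ∈ B, Q.label a = P.label a * g := by
      intro B hB hBE
      rcases h.2 B hB with h2 | ⟨_, _, _, hg⟩
      · exact absurd h2 (h0 B hB)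
      · exact hg
    obtain ⟨g, hg⟩ := hlab B hB hBE
    obtain ⟨g', hg'⟩ := hlab C hC hCE
    -- The twist `g' * g⁻¹` on `C` makes the single element `g` carry the new labels to those of `Q`
    -- on all of `B ∪ C`.
    obtain ⟨P', e1, e2, e3, e4⟩ := P.exists_nonzeroMerge hB hC (g' * g⁻¹)
    refine step P' (Or.inr ⟨B, hB, C, hC, hne, e1, e2, _, e3, fun a _ ha => e4 a ha⟩)
      ⟨e1 ▸ h.1, fun F hF => ?_⟩
    rcases Finset.mem_insert.1 (e2 ▸ hF) with rfl | hF
    · refine Or.inr ⟨E, hE, Finset.union_subset hBE hCE, g, fun a ha => ?_⟩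
      by_cases haC : a ∈ C
      · rw [e3 a haC, hg' a haC, mul_assoc, inv_mul_cancel_right]
      · rw [e4 a haC, hg a ((Finset.mem_union.1 ha).resolve_right haC)]
    · obtain ⟨hFC, hF⟩ := Finset.mem_erase.1 hF
      have hF := Finset.mem_of_mem_erase hF
      rcases h.2 F hF with h2 | ⟨E', hE', hFE', g₀, hg₀⟩
      · exact Or.inl h2
      · refine Or.inr ⟨E', hE', hFE', g₀, fun a ha => ?_⟩
        rw [e4 a fun haC => hFC (P.partition.eq_of_mem_parts hF hC ha haC), hg₀ a ha]
  · push Not at h1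
    exact (mk_eq_mk.2 (h.equivalent h0 h1)).le

theorem mk_le_mk {P Q : GPrepartition G n} : mk P ≤ mk Q ↔ P.Refines Q :=
  ⟨refines_of_mk_le, mk_le_of_refines⟩

theorem zeroHat_le (x : DowlingLattice G n) : zeroHat ≤ x := by
  obtain ⟨Q, rfl⟩ := mk_surjective x
  refine mk_le_mk.2 ⟨Finset.empty_subset _, fun B hB => ?_⟩
  obtain ⟨a, -, rfl⟩ := Finpartition.mem_bot_iff.1 hB
  by_cases ha : a ∈ Q.zeroBlock
  · exact Or.inl (Finset.singleton_subset_iff.2 ha)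
  · obtain ⟨C, hC, haC⟩ := exists_part_of_notMem ha
    exact Or.inr ⟨C, hC, Finset.singleton_subset_iff.2 haC, Q.label a, fun b hb => by
      rw [Finset.mem_singleton.1 hb, one_mul]⟩

end DowlingLattice

/-! ### The subspace attached to a prepartition by a character. -/

namespace GPrepartition

variable {G : Type*} {n : ℕ}

/-- The subspace of vectors that vanish on the zero block and are proportional to the labels on
each nonzero block. -/
def subspace [Group G] (χ : G →* ℂˣ) (P : GPrepartition G n) : Submodule ℂ (Fin n → ℂ) where
  carrier := {v | (∀ a ∈ P.zeroBlock, v a = 0) ∧ ∀ B ∈ P.partition.parts, ∀ a ∈ B, ∀ b ∈ B,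
    v a * χ (P.label b) = v b * χ (P.label a)}
  zero_mem' := by simp
  add_mem' := by
    rintro v w ⟨h1, h2⟩ ⟨h1', h2'⟩
    refine ⟨fun a ha => by simp [h1 a ha, h1' a ha], fun B hB a ha b hb => ?_⟩
    rw [Pi.add_apply, Pi.add_apply, add_mul, add_mul, h2 B hB a ha b hb, h2' B hB a ha b hb]
  smul_mem' := by
    rintro c v ⟨h1, h2⟩
    refine ⟨fun a ha => by simp [h1 a ha], fun B hB a ha b hb => ?_⟩
    rw [Pi.smul_apply, Pi.smul_apply, smul_mul_assoc, smul_mul_assoc, h2 B hB a ha b hb]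

/-- The vector supported on `B` whose entries are the labels of `P`. -/
def blockVector [Group G] (χ : G →* ℂˣ) (P : GPrepartition G n) (B : Finset (Fin n)) :
    Fin n → ℂ :=
  fun a => if a ∈ B then χ (P.label a) else 0

theorem blockVector_apply_ne_zero [Group G] {χ : G →* ℂˣ} {P : GPrepartition G n}
    {B : Finset (Fin n)} {a : Fin n} : P.blockVector χ B a ≠ 0 ↔ a ∈ B := by
  simp [blockVector]

theorem blockVector_of_mem [Group G] (χ : G →* ℂˣ) (P : GPrepartition G n)
    {B : Finset (Fin n)} {a : Fin n} (ha : a ∈ B) : P.blockVector χ B a = χ (P.label a) :=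
  if_pos ha

theorem blockVector_of_notMem [Group G] (χ : G →* ℂˣ) (P : GPrepartition G n)
    {B : Finset (Fin n)} {a : Fin n} (ha : a ∉ B) : P.blockVector χ B a = 0 :=
  if_neg ha

theorem blockVector_mem_subspace [Group G] (χ : G →* ℂˣ) (P : GPrepartition G n)
    {B : Finset (Fin n)} (hB : B ∈ P.partition.parts) :
    P.blockVector χ B ∈ P.subspace χ := by
  refine ⟨fun a ha => if_neg fun haB => notMem_zeroBlock_of_mem hB haB ha,
    fun C hC a ha b hb => ?_⟩
  by_cases h : C = B
  · subst h
    rw [blockVector_of_mem _ _ ha, blockVector_of_mem _ _ hb, mul_comm]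
  · rw [blockVector_of_notMem _ _ fun h' => h (P.partition.eq_of_mem_parts hC hB ha h'),
      blockVector_of_notMem _ _ fun h' => h (P.partition.eq_of_mem_parts hC hB hb h'),
      zero_mul, zero_mul]

theorem Refines.subspace_le [Group G] (χ : G →* ℂˣ) {P Q : GPrepartition G n}
    (h : P.Refines Q) : Q.subspace χ ≤ P.subspace χ := by
  rintro v ⟨h1, h2⟩
  refine ⟨fun a ha => h1 a (h.1 ha), fun B hB a ha b hb => ?_⟩
  rcases h.2 B hB with h3 | ⟨C, hC, hBC, g, hg⟩
  · rw [h1 a (h3 ha), h1 b (h3 hb), zero_mul, zero_mul]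
  · have h4 := h2 C hC a (hBC ha) b (hBC hb)
    rw [hg a ha, hg b hb, map_mul, map_mul, Units.val_mul, Units.val_mul, ← mul_assoc,
      ← mul_assoc] at h4
    exact mul_right_cancel₀ (χ g).ne_zero h4

/-- It suffices to test the inclusion on the block vectors of `Q`: their supports show how blocks
sit inside blocks, and the ratios of their values, by injectivity of `χ`, compare the labels. -/
theorem refines_of_subspace_le [CommGroup G] {χ : G →* ℂˣ} (hχ : Function.Injective χ)
    {P Q : GPrepartition G n} (h : Q.subspace χ ≤ P.subspace χ) : P.Refines Q := by
  have hv : ∀ C ∈ Q.partition.parts, Q.blockVector χ C ∈ P.subspace χ :=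
    fun C hC => h (Q.blockVector_mem_subspace χ hC)
  refine ⟨fun a ha => ?_, fun B hB => ?_⟩
  · by_contra haQ
    obtain ⟨C, hC, haC⟩ := exists_part_of_notMem haQ
    exact blockVector_apply_ne_zero (χ := χ).2 haC ((hv C hC).1 a ha)
  · rw [or_iff_not_imp_left, Finset.not_subset]
    rintro ⟨a, haB, haQ⟩
    obtain ⟨C, hC, haC⟩ := exists_part_of_notMem haQ
    have hBC : B ⊆ C := by
      intro b hb
      have h1 := (hv C hC).2 B hB a haB b hb
      refine (blockVector_apply_ne_zero (χ := χ) (P := Q)).1 fun h0 => ?_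
      rw [h0, zero_mul] at h1
      exact mul_ne_zero (blockVector_apply_ne_zero (χ := χ).2 haC) (χ _).ne_zero h1
    refine ⟨C, hC, hBC, (P.label a)⁻¹ * Q.label a, fun b hb => ?_⟩
    have h1 := (hv C hC).2 B hB a haB b hb
    rw [blockVector_of_mem _ _ haC, blockVector_of_mem _ _ (hBC hb)] at h1
    have h2 : Q.label a * P.label b = Q.label b * P.label a := by
      apply hχ
      rw [map_mul, map_mul]
      exact Units.ext h1
    rw [← mul_assoc, mul_right_comm, mul_comm (P.label b), h2, mul_inv_cancel_right]

end GPrepartition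

namespace DowlingLattice

variable {G : Type*} [CommGroup G] {n : ℕ}

/-- The order embedding of a Dowling lattice into the subspaces of `ℂⁿ`, ordered by reverse
inclusion, that is determined by a faithful character. -/
theorem exists_orderEmbedding {χ : G →* ℂˣ} (hχ : Function.Injective χ) :
    ∃ F : DowlingLattice G n ↪o (Submodule ℂ (Fin n → ℂ))ᵒᵈ,
      ∀ P, F (mk P) = OrderDual.toDual (P.subspace χ) := by
  have hle : ∀ {P Q : GPrepartition G n},
      P.subspace χ ≤ Q.subspace χ ↔ mk Q ≤ mk P := fun {P Q} =>
    ⟨fun h => mk_le_of_refines (GPrepartition.refines_of_subspace_le hχ h),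
      fun h => (refines_of_mk_le h).subspace_le χ⟩
  let f : DowlingLattice G n → (Submodule ℂ (Fin n → ℂ))ᵒᵈ :=
    fun x => OrderDual.toDual ((Classical.choose (mk_surjective x)).subspace χ)
  have hf : ∀ P, f (mk P) = OrderDual.toDual (P.subspace χ) := by
    intro P
    have h := Classical.choose_spec (mk_surjective (mk P))
    exact congrArg OrderDual.toDual (le_antisymm (hle.2 h.ge) (hle.2 h.le))
  refine ⟨OrderEmbedding.ofMapLEIff f fun x y => ?_, hf⟩
  obtain ⟨P, rfl⟩ := mk_surjective x
  obtain ⟨Q, rfl⟩ := mk_surjective y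
  rw [hf, hf]
  exact hle

end DowlingLattice

/-! ### Removing and adjoining bounds. -/

/-- The adjoined bounds are sent to `b` and `f t`. The hypothesis `hbot` ensures that a deleted
least element is recovered as one of these two; otherwise its image would be missed. -/
theorem nonempty_adjoinBounds_properPart_orderIso {S Q : Type*} [PartialOrder S]
    [PartialOrder Q] (f : S ↪o Q) {b : Q} (hb : IsBot b) (hsurj : ∀ q, q = b ∨ ∃ s, f s = q)
    {t : S} (ht : IsTop t) (hbt : f t ≠ b) (hbot : ∀ s, IsBot s → s = t ∨ f s = b) :
    Nonempty (AdjoinBounds (ProperPart S) ≃o Q) := by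
  have hfb : ∀ s : ProperPart S, ¬ f s.1 ≤ b := fun s hs =>
    s.2.2 fun s' => f.le_iff_le.1 (hs.trans (hb _))
  let g : AdjoinBounds (ProperPart S) → Q :=
    fun x => WithBot.recBotCoe b (fun y => WithTop.recTopCoe (f t) (fun s => f s.1) y) x
  have hg : ∀ x y, g x ≤ g y ↔ x ≤ y := by
    intro x y
    induction x using WithBot.recBotCoe with
    | bot => exact iff_of_true (hb _) bot_le
    | coe x =>
    induction y using WithBot.recBotCoe with
    | bot =>
      refine iff_of_false ?_ (WithBot.not_coe_le_bot x)
      induction x using WithTop.recTopCoe with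
      | top => exact fun h => hbt (h.antisymm (hb _))
      | coe s => exact hfb s
    | coe y =>
    rw [WithBot.coe_le_coe]
    induction y using WithTop.recTopCoe with
    | top =>
      refine iff_of_true ?_ le_top
      induction x using WithTop.recTopCoe with
      | top => exact le_rfl
      | coe s => exact f.le_iff_le.2 (ht _)
    | coe s' =>
    induction x using WithTop.recTopCoe with
    | top =>
      exact iff_of_false (fun h => s'.2.1 fun s => (ht s).trans (f.le_iff_le.1 h))
        (WithTop.not_top_le_coe s')
    | coe s =>
      rw [WithTop.coe_le_coe]
      exact f.le_iff_le
  refine ⟨OrderIso.ofRelIsoLT (RelIso.ofSurjective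
    (OrderEmbedding.ofMapLEIff g hg).ltEmbedding fun q => ?_)⟩
  rcases hsurj q with rfl | ⟨s, rfl⟩
  · exact ⟨⊥, rfl⟩
  · by_cases h1 : IsTop s
    · exact ⟨((⊤ : WithTop (ProperPart S)) : WithBot _),
        congrArg f ((h1 t).antisymm (ht s))⟩
    by_cases h2 : IsBot s
    · rcases hbot s h2 with rfl | h3
      · exact absurd ht h1
      · exact ⟨⊥, h3.symm⟩
    · exact ⟨(((⟨s, h1, h2⟩ : ProperPart S) : WithTop (ProperPart S)) : WithBot _), rfl⟩

theorem exists_isTop_eigenspacePoset {n : ℕ} {X : Set (Matrix (Fin n) (Fin n) ℂ)} {ζ : ℂ}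
    {α : Type*} [PartialOrder α] (F : α ↪o (Submodule ℂ (Fin n → ℂ))ᵒᵈ) {T : Set α}
    (hT : ∀ W, (∃ x ∈ X, W = Module.End.eigenspace (Matrix.toLin' x) ζ) ↔
      ∃ a ∈ T, F a = OrderDual.toDual W)
    {t : α} (htT : t ∈ T) (ht : ∀ a ∈ T, a ≤ t) :
    ∃ x : EigenspacePoset X ζ, IsTop x := by
  refine ⟨OrderDual.toDual ⟨OrderDual.ofDual (F t), (hT _).2 ⟨t, htT, rfl⟩⟩, ?_⟩
  rintro ⟨W, hW⟩
  obtain ⟨a, ha, haW⟩ := (hT W).1 hW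
  have h := F.le_iff_le.2 (ht a ha)
  rw [haW] at h
  exact h

/-- Here `α` parametrises candidate eigenspaces and `T` is the set of those realised. The point `b`
need not lie in `T`; this is how `zeroHat` enters even when it is not an eigenspace. -/
theorem nonempty_hat_eigenspacePoset_orderIso {n : ℕ} {X : Set (Matrix (Fin n) (Fin n) ℂ)}
    {ζ : ℂ} {α : Type*} [PartialOrder α] (F : α ↪o (Submodule ℂ (Fin n → ℂ))ᵒᵈ) {T : Set α}
    (hT : ∀ W, (∃ x ∈ X, W = Module.End.eigenspace (Matrix.toLin' x) ζ) ↔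
      ∃ a ∈ T, F a = OrderDual.toDual W)
    {t : α} (htT : t ∈ T) (ht : ∀ a ∈ T, a ≤ t) {b : α} (hb : IsBot b) (hbt : t ≠ b)
    (hbot : ∀ a ∈ T, (∀ a' ∈ T, a ≤ a') → a = t ∨ a = b) :
    Nonempty (AdjoinBounds (ProperPart (EigenspacePoset X ζ)) ≃o {x : α // x = b ∨ x ∈ T}) := by
  have hex : ∀ W : EigenspacePoset X ζ, ∃ a ∈ T, F a = OrderDual.toDual W.1 :=
    fun W => (hT W.1).1 W.2
  choose f hfT hf using hex
  have hfle : ∀ W W' : EigenspacePoset X ζ, f W ≤ f W' ↔ W ≤ W' := by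
    intro W W'
    rw [← F.le_iff_le, hf, hf]
    exact Iff.rfl
  have hsurj : ∀ a ∈ T, ∃ W, f W = a := by
    intro a ha
    refine ⟨OrderDual.toDual ⟨OrderDual.ofDual (F a), (hT _).2 ⟨a, ha, rfl⟩⟩, ?_⟩
    exact F.injective (hf _)
  obtain ⟨t', ht'⟩ := hsurj t htT
  let g : EigenspacePoset X ζ ↪o {x : α // x = b ∨ x ∈ T} :=
    OrderEmbedding.ofMapLEIff (fun W => ⟨f W, Or.inr (hfT W)⟩) hfle
  refine nonempty_adjoinBounds_properPart_orderIso g (b := ⟨b, Or.inl rfl⟩) (t := t')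
    (fun x => hb x.1) ?_ (fun W => (hfle _ _).1 (ht'.symm ▸ ht _ (hfT W)))
    (fun h => hbt (ht'.symm.trans (congrArg Subtype.val h))) ?_
  · rintro ⟨q, rfl | hq⟩
    · exact Or.inl rfl
    · obtain ⟨W, hW⟩ := hsurj q hq
      exact Or.inr ⟨W, Subtype.ext hW⟩
  · intro W hW
    rcases hbot (f W) (hfT W) fun a' ha' => by
      obtain ⟨W', rfl⟩ := hsurj a' ha'
      exact (hfle _ _).2 (hW W') with h | h
    · refine Or.inl ?_
      have h' := h.trans ht'.symm
      exact le_antisymm ((hfle _ _).1 h'.le) ((hfle _ _).1 h'.ge)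
    · exact Or.inr (Subtype.ext h)

/-! ### Roots of unity, setoids, cycles and characters. -/

theorem ne_zero_of_pow_eq_one_of_pos {r : ℕ} {ξ : ℂ} (hr : 0 < r) (hξ : ξ ^ r = 1) : ξ ≠ 0 := by
  rintro rfl
  rw [zero_pow hr.ne'] at hξ
  exact zero_ne_one hξ

theorem div_gcd_pos {r m d : ℕ} (hm : 0 < m) (hd : d = m / Nat.gcd m r) : 0 < d :=
  hd ▸ Nat.div_pos (Nat.gcd_le_left r hm) (Nat.gcd_pos_of_pos_left r hm)

/-- This is the meaning of `d` throughout: it is the order of `ζ ^ r`. -/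
theorem IsPrimitiveRoot.pow_of_div_gcd {r m d : ℕ} (hr : 0 < r) (hd : d = m / Nat.gcd m r) {ζ : ℂ}
    (hζ : IsPrimitiveRoot ζ m) : IsPrimitiveRoot (ζ ^ r) d := by
  rw [IsPrimitiveRoot.iff_orderOf, orderOf_pow' _ hr.ne', ← hζ.eq_orderOf, hd]

open Classical in
theorem GPrepartition.exists_of_setoid {G : Type*} {n : ℕ} (I : Finset (Fin n))
    (s : Setoid (Fin n)) (l : Fin n → G) :
    ∃ P : GPrepartition G n, P.zeroBlock = I ∧ P.label = l ∧
      ∀ B, B ∈ P.partition.parts ↔ ∃ a ∉ I, ∀ b, b ∈ B ↔ b ∉ I ∧ s a b := by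
  refine ⟨⟨I, Finpartition.ofSetSetoid s Iᶜ, l⟩, rfl, rfl, fun B => ?_⟩
  simp only [Finpartition.ofSetSetoid_parts, Finset.mem_image, Finset.mem_compl]
  refine exists_congr fun a => and_congr_right fun ha => ?_
  rw [Finset.ext_iff]
  simp only [Finset.mem_filter, Finset.mem_compl]
  exact forall_congr' fun b => ⟨fun h => h.symm, fun h => h.symm⟩

theorem Equiv.Perm.SameCycle.induction_on {α : Type*} [Finite α] {σ : Equiv.Perm α}
    {p : α → Prop} {a b : α} (h : σ.SameCycle a b) (hp : ∀ c, p c → p (σ c)) (ha : p a) :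
    p b := by
  obtain ⟨i, rfl⟩ := h.exists_nat_pow_eq
  induction i with
  | zero => exact ha
  | succ i ih =>
    rw [pow_succ', Equiv.Perm.mul_apply]
    exact hp _ (ih ⟨i, by simp⟩)

theorem IsPrimitiveRoot.pow_eq_pow_iff_modEq' {κ : ℂ} {d : ℕ} (hκ : IsPrimitiveRoot κ d)
    (hd : 0 < d) (i j : ℕ) : κ ^ i = κ ^ j ↔ i ≡ j [MOD d] := by
  have h : ∀ i, κ ^ i = κ ^ (i % d) := fun i => pow_eq_pow_mod i hκ.pow_eq_one
  rw [h i, h j]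
  exact ⟨fun h => hκ.pow_inj (Nat.mod_lt _ hd) (Nat.mod_lt _ hd) h,
    fun h => by rw [show i % d = j % d from h]⟩

theorem IsPrimitiveRoot.exists_character {N : ℕ} [NeZero N] {ω : ℂ} (hω : IsPrimitiveRoot ω N) :
    ∃ χ : Multiplicative (ZMod N) →* ℂˣ, Function.Injective χ ∧
      (∀ g, (χ g : ℂ) = ω ^ (Multiplicative.toAdd g).val) ∧
      ∀ z : ℂ, z ^ N = 1 → ∃ g, (χ g : ℂ) = z := by
  have hN : 0 < N := Nat.pos_of_ne_zero (NeZero.ne N)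
  have hu : ω * ω⁻¹ = 1 := mul_inv_cancel₀ (hω.ne_zero (NeZero.ne N))
  let u : ℂˣ := ⟨ω, ω⁻¹, hu, by rw [mul_comm, hu]⟩
  have hval : ∀ i : ℕ, ((u ^ i : ℂˣ) : ℂ) = ω ^ i := fun i => Units.val_pow_eq_pow_val u i
  let χ : Multiplicative (ZMod N) →* ℂˣ :=
    { toFun := fun g => u ^ (Multiplicative.toAdd g).val
      map_one' := by simp
      map_mul' := fun g h => by
        apply Units.ext
        rw [Units.val_mul, hval, hval, hval, ← pow_add, toAdd_mul, ZMod.val_add]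
        exact (pow_eq_pow_mod _ hω.pow_eq_one).symm }
  have hχ : ∀ g, (χ g : ℂ) = ω ^ (Multiplicative.toAdd g).val := fun g => hval _
  refine ⟨χ, fun g h hgh => ?_, hχ, fun z hz => ?_⟩
  · have := congrArg Units.val hgh
    rw [hχ, hχ] at this
    exact Multiplicative.toAdd.injective
      (ZMod.val_injective N (hω.pow_inj (ZMod.val_lt _) (ZMod.val_lt _) this))
  · obtain ⟨i, hi, rfl⟩ := hω.eq_pow_of_pow_eq_one hz
    exact ⟨Multiplicative.ofAdd (i : ZMod N), by
      rw [hχ, toAdd_ofAdd, ZMod.val_natCast, Nat.mod_eq_of_lt hi]⟩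

/-! ### Even colourings. -/

namespace GPrepartition

/-- The residue of a label modulo `d` is visible in the `r`-th power of its character value, because
`ω ^ r` is a primitive `d`-th root of unity. -/
theorem isEvenlyColoured_iff {n d r : ℕ} (hd : 0 < d) (hr : 0 < r) {ω : ℂ}
    (hω : IsPrimitiveRoot ω (d * r)) {χ : Multiplicative (ZMod (d * r)) →* ℂˣ}
    (hχ : ∀ g, (χ g : ℂ) = ω ^ (Multiplicative.toAdd g).val)
    {P : GPrepartition (Multiplicative (ZMod (d * r))) n} :
    P.IsEvenlyColoured d ↔ ∀ B ∈ P.partition.parts, ∀ i j : ℕ,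
      (B.filter fun a => (χ (P.label a) : ℂ) ^ r = (ω ^ r) ^ i).card =
        (B.filter fun a => (χ (P.label a) : ℂ) ^ r = (ω ^ r) ^ j).card := by
  have hκ : IsPrimitiveRoot (ω ^ r) d := hω.pow (Nat.mul_pos hd hr) (mul_comm d r)
  have h : ∀ (B : Finset (Fin n)) (i : ℕ),
      (B.filter fun a => (Multiplicative.toAdd (P.label a)).val ≡ i [MOD d]) =
        B.filter fun a => (χ (P.label a) : ℂ) ^ r = (ω ^ r) ^ i := by
    intro B i
    refine Finset.filter_congr fun a _ => ?_
    rw [hχ, pow_right_comm]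
    exact (hκ.pow_eq_pow_iff_modEq' hd _ _).symm
  simp only [IsEvenlyColoured, h]

theorem IsEvenlyColoured.card_eq {n d N : ℕ} (hd : 0 < d)
    {P : GPrepartition (Multiplicative (ZMod N)) n} (h : P.IsEvenlyColoured d)
    {B : Finset (Fin n)} (hB : B ∈ P.partition.parts) (j : ℕ) :
    B.card = d * (B.filter fun a => (Multiplicative.toAdd (P.label a)).val ≡ j [MOD d]).card := by
  have hmaps : Set.MapsTo (fun a => (Multiplicative.toAdd (P.label a)).val % d) (B : Set (Fin n))
      (Finset.range d : Set ℕ) := fun a _ => Finset.mem_coe.2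
        (Finset.mem_range.2 (Nat.mod_lt _ hd))
  rw [Finset.card_eq_sum_card_fiberwise hmaps]
  rw [Finset.sum_congr rfl (g := fun _ => (B.filter fun a =>
    (Multiplicative.toAdd (P.label a)).val ≡ j [MOD d]).card), Finset.sum_const,
    Finset.card_range, smul_eq_mul]
  intro i hi
  rw [← h B hB i j]
  refine congrArg Finset.card (Finset.filter_congr fun a _ => ?_)
  rw [Nat.ModEq, Nat.mod_eq_of_lt (Finset.mem_range.1 hi)]

theorem IsEvenlyColoured.isDivisible {n d N : ℕ} (hd : 0 < d)
    {P : GPrepartition (Multiplicative (ZMod N)) n} (h : P.IsEvenlyColoured d) :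
    P.IsDivisible d :=
  fun _ hB => ⟨_, h.card_eq hd hB 0⟩

/-- The nonzero blocks partition the complement of the zero block. The use of this is that `ζ ^ (n -
|I|)` is then an `r`-th root of unity. -/
theorem IsDivisible.dvd_sub_card {G : Type*} {n d : ℕ} {P : GPrepartition G n}
    (h : P.IsDivisible d) : d ∣ n - P.zeroBlock.card := by
  have hsum := P.partition.sum_card_parts
  rw [Finset.card_compl, Fintype.card_fin] at hsum
  exact hsum ▸ Finset.dvd_sum fun B hB => h B hB

end GPrepartition

/-- If a permutation of a finite set multiplies the values of `φ` by `ρ`, then the fibres of `φ`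
over the powers of `ρ` are equinumerous. -/
theorem card_fiber_le_of_apply_perm {α : Type*} [DecidableEq α] {σ : Equiv.Perm α} {B : Finset α}
    (hB : ∀ a ∈ B, σ a ∈ B) {φ : α → ℂ} {ρ : ℂ} (hφ : ∀ a ∈ B, φ (σ a) = ρ * φ a) (z : ℂ)
    (k : ℕ) : (B.filter fun a => φ a = z).card ≤ (B.filter fun a => φ a = ρ ^ k * z).card := by
  induction k with
  | zero => simp
  | succ k ih =>
    refine ih.trans (Finset.card_le_card_of_injOn σ (fun a ha => ?_) σ.injective.injOn)
    obtain ⟨h1, h2⟩ := Finset.mem_filter.1 (Finset.mem_coe.1 ha)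
    exact Finset.mem_coe.2 (Finset.mem_filter.2 ⟨hB a h1, by rw [hφ a h1, h2, pow_succ', mul_assoc]⟩)

/-! ### Eigenspaces of monomial matrices. -/

section Eigenspace

variable {n : ℕ}

theorem mem_eigenspace_monomialMatrix {θ : Fin n → ℂˣ} {σ : Equiv.Perm (Fin n)} {ζ : ℂ}
    {v : Fin n → ℂ} :
    v ∈ Module.End.eigenspace (Matrix.toLin' (monomialMatrix θ σ)) ζ ↔
      ∀ a, (θ (σ a) : ℂ) * v a = ζ * v (σ a) := by
  rw [Module.End.mem_eigenspace_iff, Matrix.toLin'_apply, funext_iff]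
  have h : ∀ a, (monomialMatrix θ σ).mulVec v (σ a) = θ (σ a) * v a := by
    intro a
    rw [Matrix.mulVec, dotProduct, Finset.sum_eq_single a]
    · simp [monomialMatrix]
    · intro b _ hb
      simp [monomialMatrix, hb.symm]
    · simp
  exact ⟨fun H a => by rw [← h, H (σ a)]; rfl, fun H i => by
    obtain ⟨a, rfl⟩ := σ.surjective i
    rw [h, H a]; rfl⟩

theorem eigenvector_eq_zero_of_sameCycle {θ : Fin n → ℂˣ} {σ : Equiv.Perm (Fin n)} {ζ : ℂ}
    (hζ : ζ ≠ 0) {v : Fin n → ℂ}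
    (hv : v ∈ Module.End.eigenspace (Matrix.toLin' (monomialMatrix θ σ)) ζ) {a b : Fin n}
    (hab : σ.SameCycle a b) (ha : v a = 0) : v b = 0 := by
  rw [mem_eigenspace_monomialMatrix] at hv
  refine hab.induction_on (p := fun c => v c = 0) (fun c hc => ?_) ha
  have h := hv c
  rw [hc, mul_zero] at h
  exact (mul_eq_zero.1 h.symm).resolve_left hζ

/-- An eigenvector of a monomial matrix of maximal support whose nonzero entries are roots of
unity. -/
theorem exists_generic_eigenvector {θ : Fin n → ℂˣ} {σ : Equiv.Perm (Fin n)} {ζ : ℂ} {N : ℕ}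
    (hζ : ζ ≠ 0) (hζN : ζ ^ N = 1) (hθ : ∀ i, θ i ^ N = 1) :
    ∃ v ∈ Module.End.eigenspace (Matrix.toLin' (monomialMatrix θ σ)) ζ,
      (∀ a, v a = 0 → ∀ u ∈ Module.End.eigenspace (Matrix.toLin' (monomialMatrix θ σ)) ζ,
        u a = 0) ∧ ∀ a, v a ≠ 0 → v a ^ N = 1 := by
  set W := Module.End.eigenspace (Matrix.toLin' (monomialMatrix θ σ)) ζ with hW
  -- Normalising to the value `1` at `c` makes all values on the cycle of `c` roots of unity.
  have hex : ∀ c : Fin n, ∃ w ∈ W, w c = 1 ∨ ∀ u ∈ W, u c = 0 := by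
    intro c
    by_cases h : ∀ u ∈ W, u c = 0
    · exact ⟨0, W.zero_mem, Or.inr h⟩
    · push Not at h
      obtain ⟨u, hu, huc⟩ := h
      exact ⟨(u c)⁻¹ • u, W.smul_mem _ hu, Or.inl (by simp [huc])⟩
  choose w hwW hw using hex
  -- On each cycle the eigenvector chosen at its representative is used. The eigenvector equation
  -- only relates coordinates in one cycle, so the glued vector is again an eigenvector.
  let rep : Fin n → Fin n := fun a => (Quotient.mk (Equiv.Perm.SameCycle.setoid σ) a).out
  have hrep : ∀ a, σ.SameCycle (rep a) a := fun a =>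
    Quotient.exact (Quotient.out_eq (Quotient.mk (Equiv.Perm.SameCycle.setoid σ) a))
  have hrepσ : ∀ a, rep (σ a) = rep a := fun a =>
    congrArg Quotient.out (Quotient.sound (s := Equiv.Perm.SameCycle.setoid σ)
      (Equiv.Perm.sameCycle_apply_left.2 (Equiv.Perm.SameCycle.refl σ a)))
  refine ⟨fun a => w (rep a) a, ?_, fun a ha u hu => ?_, fun a ha => ?_⟩
  · rw [hW, mem_eigenspace_monomialMatrix]
    intro a
    rw [hrepσ]
    exact mem_eigenspace_monomialMatrix.1 (hwW (rep a)) a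
  · rcases hw (rep a) with h | h
    · have := eigenvector_eq_zero_of_sameCycle hζ (hwW (rep a)) (hrep a).symm ha
      exact absurd (h.symm.trans this) one_ne_zero
    · exact eigenvector_eq_zero_of_sameCycle hζ hu (hrep a) (h u hu)
  · rcases hw (rep a) with h | h
    · refine (hrep a).induction_on (p := fun c => w (rep a) c ^ N = 1) (fun c hc => ?_)
        (by rw [h, one_pow])
      have h2 := congrArg (· ^ N) (mem_eigenspace_monomialMatrix.1 (hwW (rep a)) c)
      simp only [mul_pow, hc, hζN, one_mul, mul_one] at h2
      rw [← h2, ← Units.val_pow_eq_pow_val, hθ, Units.val_one]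
    · exact absurd (h _ (hwW (rep a))) fun h0 =>
        ha (eigenvector_eq_zero_of_sameCycle hζ (hwW (rep a)) (hrep a) h0)

/-- The combination `u a • v - v a • u` is an eigenvector that vanishes at `a`, hence on the whole
cycle. -/
theorem eigenvector_proportional {θ : Fin n → ℂˣ} {σ : Equiv.Perm (Fin n)} {ζ : ℂ}
    (hζ : ζ ≠ 0) {u v : Fin n → ℂ}
    (hu : u ∈ Module.End.eigenspace (Matrix.toLin' (monomialMatrix θ σ)) ζ)
    (hv : v ∈ Module.End.eigenspace (Matrix.toLin' (monomialMatrix θ σ)) ζ) {a b : Fin n}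
    (hab : σ.SameCycle a b) : u a * v b = u b * v a := by
  have h := eigenvector_eq_zero_of_sameCycle hζ
    (Submodule.sub_mem _ (Submodule.smul_mem _ (u a) hv) (Submodule.smul_mem _ (v a) hu)) hab
    (by simp [mul_comm])
  simp only [Pi.sub_apply, Pi.smul_apply, smul_eq_mul] at h
  rw [sub_eq_zero.1 h, mul_comm]

/-- Multiply the eigenvector equations over `S`: since `S` is `σ`-stable, the coordinates of `v`
cancel. -/
theorem prod_eq_pow_of_eigenvector {θ : Fin n → ℂˣ} {σ : Equiv.Perm (Fin n)} {ζ : ℂ}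
    {v : Fin n → ℂ}
    (hv : v ∈ Module.End.eigenspace (Matrix.toLin' (monomialMatrix θ σ)) ζ)
    {S : Finset (Fin n)} (hS : ∀ a, a ∈ S ↔ σ a ∈ S) (hvS : ∀ a ∈ S, v a ≠ 0) :
    ∏ a ∈ S, (θ a : ℂ) = ζ ^ S.card := by
  have h := Finset.prod_congr (s₁ := S) rfl fun b _ => mem_eigenspace_monomialMatrix.1 hv b
  rw [Finset.prod_mul_distrib, Finset.prod_mul_distrib, Finset.prod_const,
    Finset.prod_equiv σ (g := fun b => (θ b : ℂ)) hS fun _ _ => rfl,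
    Finset.prod_equiv σ (g := fun b => v b) hS fun _ _ => rfl] at h
  exact mul_right_cancel₀ (Finset.prod_ne_zero_iff.2 hvS) h

/-- A generic eigenvector supplies everything: its zeros form the zero block, the cycles on its
support are the blocks, and its values are the labels. -/
theorem exists_subspace_eq_eigenspace {r m d : ℕ} (hr : 0 < r) (hm : 0 < m)
    (hd : d = m / Nat.gcd m r) {ζ : ℂ} (hζ : IsPrimitiveRoot ζ m) {ω : ℂ}
    (hω : IsPrimitiveRoot ω (d * r)) {χ : Multiplicative (ZMod (d * r)) →* ℂˣ}
    (hχ : ∀ g, (χ g : ℂ) = ω ^ (Multiplicative.toAdd g).val)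
    (hχs : ∀ z : ℂ, z ^ (d * r) = 1 → ∃ g, (χ g : ℂ) = z)
    {θ : Fin n → ℂˣ} (σ : Equiv.Perm (Fin n)) (hθ : ∀ i, θ i ^ r = 1) :
    ∃ P : GPrepartition (Multiplicative (ZMod (d * r))) n, P.IsEvenlyColoured d ∧
      P.subspace χ = Module.End.eigenspace (Matrix.toLin' (monomialMatrix θ σ)) ζ ∧
      ∃ v ∈ Module.End.eigenspace (Matrix.toLin' (monomialMatrix θ σ)) ζ,
        ∀ a, v a = 0 ↔ a ∈ P.zeroBlock := by
  have hζ0 : ζ ≠ 0 := hζ.ne_zero hm.ne'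
  have hd0 : 0 < d := div_gcd_pos hm hd
  have hζr : IsPrimitiveRoot (ζ ^ r) d := hζ.pow_of_div_gcd hr hd
  obtain ⟨v, hv, hv0, hvN⟩ := exists_generic_eigenvector (σ := σ) (N := d * r) (θ := θ) hζ0
    (by rw [mul_comm, pow_mul, hζr.pow_eq_one])
    (fun i => by rw [mul_comm, pow_mul, hθ, one_pow])
  have hvσ := mem_eigenspace_monomialMatrix.1 hv
  have hl : ∀ a, ∃ g, v a ≠ 0 → (χ g : ℂ) = v a := by
    intro a
    by_cases h : v a = 0
    · exact ⟨1, fun h' => absurd h h'⟩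
    · obtain ⟨g, hg⟩ := hχs _ (hvN a h)
      exact ⟨g, fun _ => hg⟩
  choose l hl using hl
  obtain ⟨P, hP0, hPl, hPB⟩ := GPrepartition.exists_of_setoid
    (Finset.univ.filter fun a => v a = 0) (Equiv.Perm.SameCycle.setoid σ) l
  have hz : ∀ a, v a = 0 ↔ a ∈ P.zeroBlock := by simp [hP0]
  have hlab : ∀ a, v a ≠ 0 → (χ (P.label a) : ℂ) = v a := fun a ha => hPl ▸ hl a ha
  have hB : ∀ B ∈ P.partition.parts, ∃ a, v a ≠ 0 ∧ ∀ b, b ∈ B ↔ σ.SameCycle a b := by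
    intro B hB
    obtain ⟨a, ha, hab⟩ := (hPB B).1 hB
    have ha' : v a ≠ 0 := by simpa using ha
    refine ⟨a, ha', fun b => (hab b).trans ⟨fun h => h.2, fun h => ⟨?_, h⟩⟩⟩
    simpa using fun hb => ha' (eigenvector_eq_zero_of_sameCycle hζ0 hv h.symm hb)
  have hne : ∀ B ∈ P.partition.parts, ∀ a ∈ B, v a ≠ 0 := fun B hB a ha h =>
    GPrepartition.notMem_zeroBlock_of_mem hB ha ((hz a).1 h)
  refine ⟨P, ?_, ?_, v, hv, hz⟩
  · rw [GPrepartition.isEvenlyColoured_iff hd0 hr hω hχ]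
    intro B hBP
    obtain ⟨c, -, hc⟩ := hB B hBP
    have hBσ : ∀ a ∈ B, σ a ∈ B := fun a ha =>
      (hc _).2 (Equiv.Perm.sameCycle_apply_right.2 ((hc a).1 ha))
    have hφ : ∀ a ∈ B, (χ (P.label (σ a)) : ℂ) ^ r = (ζ ^ r)⁻¹ * (χ (P.label a) : ℂ) ^ r := by
      intro a ha
      rw [hlab a (hne B hBP a ha), hlab (σ a) (hne B hBP _ (hBσ a ha)),
        eq_inv_mul_iff_mul_eq₀ (pow_ne_zero r hζ0), ← mul_pow, ← hvσ a, mul_pow,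
        ← Units.val_pow_eq_pow_val, hθ, Units.val_one, one_mul]
    -- Powers of `(ζ ^ r)⁻¹` reach every `d`-th root of unity, so iterating `σ` injects any fibre
    -- into any other.
    have hle : ∀ i j : ℕ,
        (B.filter fun a => (χ (P.label a) : ℂ) ^ r = (ω ^ r) ^ i).card ≤
          (B.filter fun a => (χ (P.label a) : ℂ) ^ r = (ω ^ r) ^ j).card := by
      intro i j
      have hκ : (ω ^ r) ^ d = 1 := by rw [← pow_mul, mul_comm, hω.pow_eq_one]
      have hκ0 : (ω ^ r) ≠ 0 := pow_ne_zero _ (hω.ne_zero (Nat.mul_pos hd0 hr).ne')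
      have : NeZero d := ⟨hd0.ne'⟩
      obtain ⟨k, -, hk⟩ := hζr.inv.eq_pow_of_pow_eq_one
        (ξ := (ω ^ r) ^ j * ((ω ^ r) ^ i)⁻¹) (by
          rw [mul_pow, inv_pow, pow_right_comm _ j, pow_right_comm _ i, hκ, one_pow, one_pow,
            inv_one, one_mul])
      have := card_fiber_le_of_apply_perm
        (φ := fun a => (χ (P.label a) : ℂ) ^ r) hBσ hφ ((ω ^ r) ^ i) k
      rwa [hk, inv_mul_cancel_right₀ (pow_ne_zero i hκ0)] at this
    exact fun i j => (hle i j).antisymm (hle j i)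
  · refine le_antisymm (fun u hu => ?_) fun u hu => ⟨fun a ha => hv0 a ((hz a).2 ha) u hu,
      fun B hBP a ha b hb => ?_⟩
    · obtain ⟨hu0, huB⟩ := hu
      rw [mem_eigenspace_monomialMatrix]
      intro a
      by_cases ha : v a = 0
      · have ha' := eigenvector_eq_zero_of_sameCycle hζ0 hv
          (Equiv.Perm.sameCycle_apply_right.2 (Equiv.Perm.SameCycle.refl σ a)) ha
        rw [hu0 a ((hz a).1 ha), hu0 _ ((hz _).1 ha'), mul_zero, mul_zero]
      · obtain ⟨B, hBP, haB⟩ := GPrepartition.exists_part_of_notMem fun h => ha ((hz a).2 h)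
        obtain ⟨c, -, hc⟩ := hB B hBP
        have haB' : σ a ∈ B := (hc _).2 (Equiv.Perm.sameCycle_apply_right.2 ((hc a).1 haB))
        have h := huB B hBP a haB _ haB'
        rw [hlab _ (hne B hBP a haB), hlab _ (hne B hBP _ haB')] at h
        refine mul_right_cancel₀ ha ?_
        rw [mul_assoc, mul_assoc, ← h, mul_left_comm ζ, ← hvσ a]
        ring
    · obtain ⟨c, -, hc⟩ := hB B hBP
      rw [hlab _ (hne B hBP a ha), hlab _ (hne B hBP b hb)]
      exact eigenvector_proportional hζ0 hu hv (((hc a).1 ha).symm.trans ((hc b).1 hb))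

end Eigenspace

/-! ### Permutations and matrices with prescribed cycles. -/

theorem card_eq_mul_card_fiber {α : Type*} [Fintype α] {d : ℕ} (hd : 0 < d) {ρ : ℂ}
    (hρ : IsPrimitiveRoot ρ d) {φ : α → ℂ} (hφ : ∀ a, φ a ^ d = 1)
    (h : ∀ i j : ℕ, (Finset.univ.filter fun a => φ a = ρ ^ i).card =
      (Finset.univ.filter fun a => φ a = ρ ^ j).card) (j : ℕ) :
    Fintype.card α = d * (Finset.univ.filter fun a => φ a = ρ ^ j).card := by
  have : NeZero d := ⟨hd.ne'⟩
  have hmaps : Set.MapsTo φ (Finset.univ : Finset α)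
      ((Finset.range d).image fun i => ρ ^ i : Finset ℂ) := by
    intro a _
    obtain ⟨i, hi, hia⟩ := hρ.eq_pow_of_pow_eq_one (hφ a)
    exact Finset.mem_coe.2 (Finset.mem_image.2 ⟨i, Finset.mem_range.2 hi, hia⟩)
  rw [← Finset.card_univ, Finset.card_eq_sum_card_fiberwise hmaps, Finset.sum_image,
    Finset.sum_congr rfl (fun i _ => h i j), Finset.sum_const, Finset.card_range, smul_eq_mul]
  exact fun i hi i' hi' hii => hρ.pow_inj (Finset.mem_range.1 hi) (Finset.mem_range.1 hi') hii

/-- If the fibres of `φ` over the `d`-th roots of unity are equinumerous, then there is a cyclic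
permutation that multiplies the values of `φ` by a given primitive `d`-th root of unity. -/
theorem exists_cyclic_perm {α : Type*} [Fintype α] {d : ℕ} (hd : 0 < d) {ρ : ℂ}
    (hρ : IsPrimitiveRoot ρ d) {φ : α → ℂ} (hφ : ∀ a, φ a ^ d = 1)
    (h : ∀ i j : ℕ, (Finset.univ.filter fun a => φ a = ρ ^ i).card =
      (Finset.univ.filter fun a => φ a = ρ ^ j).card) :
    ∃ σ : Equiv.Perm α, (∀ a, φ (σ a) = ρ * φ a) ∧ ∀ a b, σ.SameCycle a b := by
  have : NeZero d := ⟨hd.ne'⟩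
  rcases isEmpty_or_nonempty α with hα | hα
  · exact ⟨1, fun a => isEmptyElim a, fun a => isEmptyElim a⟩
  obtain ⟨N, hN⟩ : ∃ N, N = Fintype.card α := ⟨_, rfl⟩
  have : NeZero N := ⟨hN ▸ Fintype.card_ne_zero⟩
  have hdN : d ∣ N := ⟨_, hN.trans (card_eq_mul_card_fiber hd hρ hφ h 0)⟩
  have hρN : ρ ^ N = 1 := (hρ.pow_eq_one_iff_dvd N).2 hdN
  -- The model is `q ↦ ρ ^ q` on `ZMod N`, where adding `1` is a single cycle. As `d ∣ N`, it is
  -- compatible with the wrap-around and its fibres have the sizes of those of `φ`, so the cycle can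
  -- be transported.
  let ψ : ZMod N → ℂ := fun q => ρ ^ q.val
  have hψ1 : ∀ q, ψ (q + 1) = ρ * ψ q := by
    intro q
    change ρ ^ (q + 1).val = ρ * ρ ^ q.val
    rw [ZMod.val_add, ← pow_eq_pow_mod _ hρN, pow_add, mul_comm, ← Nat.cast_one,
      ZMod.val_natCast, ← pow_eq_pow_mod _ hρN, pow_one]
  have hψd : ∀ q, ψ q ^ d = 1 := fun q => by
    rw [← pow_mul, mul_comm, pow_mul, hρ.pow_eq_one, one_pow]
  have hle : ∀ i j : ℕ, (Finset.univ.filter fun q => ψ q = ρ ^ i).card ≤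
      (Finset.univ.filter fun q => ψ q = ρ ^ j).card := by
    intro i j
    obtain ⟨k, -, hk⟩ := hρ.eq_pow_of_pow_eq_one (ξ := ρ ^ j * (ρ ^ i)⁻¹) (by
      rw [mul_pow, inv_pow, pow_right_comm _ j, pow_right_comm _ i, hρ.pow_eq_one, one_pow,
        one_pow, inv_one, one_mul])
    have := card_fiber_le_of_apply_perm (σ := Equiv.addRight (1 : ZMod N))
      (B := Finset.univ) (fun _ _ => Finset.mem_univ _) (fun q _ => hψ1 q) (ρ ^ i) k
    rwa [hk, inv_mul_cancel_right₀ (pow_ne_zero i (hρ.ne_zero hd.ne'))] at this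
  have hcard : ∀ z, Fintype.card {a // φ a = z} = Fintype.card {q // ψ q = z} := by
    intro z
    by_cases hz : z ^ d = 1
    · obtain ⟨i, -, rfl⟩ := hρ.eq_pow_of_pow_eq_one hz
      rw [Fintype.card_subtype, Fintype.card_subtype]
      refine Nat.eq_of_mul_eq_mul_left hd ?_
      rw [← card_eq_mul_card_fiber hd hρ hφ h i, ← card_eq_mul_card_fiber hd hρ hψd
        (fun i j => (hle i j).antisymm (hle j i)) i, ZMod.card, hN]
    · have h1 : IsEmpty {a // φ a = z} := ⟨fun a => hz (a.2 ▸ hφ a.1)⟩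
      have h2 : IsEmpty {q // ψ q = z} := ⟨fun q => hz (q.2 ▸ hψd q.1)⟩
      rw [Fintype.card_eq_zero, Fintype.card_eq_zero]
  let e : α ≃ ZMod N := Equiv.ofFiberEquiv (f := φ) (g := ψ) fun z => Fintype.equivOfCardEq (hcard z)
  have he : ∀ a, ψ (e a) = φ a := fun a => Equiv.ofFiberEquiv_map _ a
  let σ : Equiv.Perm α := (e.trans (Equiv.addRight 1)).trans e.symm
  have hσ : ∀ a, e (σ a) = e a + 1 := fun a => e.apply_symm_apply _
  have hpow : ∀ (k : ℕ) a, e ((σ ^ k) a) = e a + k := by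
    intro k a
    induction k with
    | zero => simp
    | succ k ih => rw [pow_succ', Equiv.Perm.mul_apply, hσ, ih, Nat.cast_succ, add_assoc]
  refine ⟨σ, fun a => by rw [← he, hσ, hψ1, he], fun a b => ⟨((e b - e a).val : ℕ), ?_⟩⟩
  rw [zpow_natCast]
  apply e.injective
  rw [hpow, ZMod.natCast_zmod_val, add_sub_cancel]

/-- The cyclic permutations of the fibres glue to a permutation whose cycles are exactly the fibres.
-/
theorem exists_perm_of_fibers {α κ : Type*} (key : α → κ) (p : α → α → Prop)
    (h : ∀ k, ∃ τ : Equiv.Perm {a // key a = k}, (∀ a, p a.1 (τ a).1) ∧ ∀ a b, τ.SameCycle a b) :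
    ∃ σ : Equiv.Perm α, (∀ a b, σ.SameCycle a b ↔ key a = key b) ∧ ∀ a, p a (σ a) := by
  choose τ hτp hτ using h
  let σ : Equiv.Perm α := Equiv.ofFiberEquiv (f := key) (g := key) τ
  have hσ : ∀ k (a : {a // key a = k}), σ a.1 = (τ k a).1 := by
    rintro _ ⟨a, rfl⟩
    rfl
  have hkey : ∀ a, key (σ a) = key a := fun a => Equiv.ofFiberEquiv_map _ a
  have hpow : ∀ k (a : {a // key a = k}) (i : ℤ), (σ ^ i) a.1 = ((τ k ^ i) a).1 := by
    intro k a i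
    induction i with
    | zero => rfl
    | succ i ih => rw [add_comm, zpow_add, zpow_add, Equiv.Perm.mul_apply, ih, zpow_one,
        zpow_one, hσ, Equiv.Perm.mul_apply]
    | pred i ih =>
      rw [sub_eq_neg_add, zpow_add, zpow_add, Equiv.Perm.mul_apply, ih, Equiv.Perm.mul_apply,
        zpow_neg_one, zpow_neg_one, Equiv.Perm.inv_eq_iff_eq, hσ,
        ← Equiv.Perm.mul_apply, mul_inv_cancel, Equiv.Perm.one_apply]
  refine ⟨σ, fun a b => ⟨?_, fun hab => ?_⟩, fun a => hτp _ ⟨a, rfl⟩⟩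
  · rintro ⟨i, rfl⟩
    rw [hpow _ ⟨a, rfl⟩ i]
    exact ((τ (key a) ^ i) ⟨a, rfl⟩).2.symm
  · obtain ⟨i, hi⟩ := hτ _ ⟨a, hab⟩ ⟨b, rfl⟩
    exact ⟨i, by rw [hpow _ ⟨a, hab⟩ i, hi]⟩

section Realisation

variable {n : ℕ}

/-- There is a permutation whose cycles on the complement of the zero block are the blocks, and
which there shifts the residue classes of the labels, while on the zero block its cycles are the
fibres of a given function. -/
theorem GPrepartition.IsEvenlyColoured.exists_perm {r d : ℕ} (hr : 0 < r) (hd : 0 < d)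
    {ρ : ℂ} (hρ : IsPrimitiveRoot ρ d) {ω : ℂ} (hω : IsPrimitiveRoot ω (d * r))
    {χ : Multiplicative (ZMod (d * r)) →* ℂˣ}
    (hχ : ∀ g, (χ g : ℂ) = ω ^ (Multiplicative.toAdd g).val)
    {P : GPrepartition (Multiplicative (ZMod (d * r))) n} (hP : P.IsEvenlyColoured d)
    (f : Fin n → ℕ) :
    ∃ σ : Equiv.Perm (Fin n), (∀ B ∈ P.partition.parts, ∀ a ∈ B, ∀ b, σ.SameCycle a b ↔ b ∈ B) ∧
      (∀ a ∈ P.zeroBlock, ∀ b, σ.SameCycle a b ↔ b ∈ P.zeroBlock ∧ f a = f b) ∧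
      ∀ a ∉ P.zeroBlock,
        (χ (P.label (σ a)) : ℂ) ^ r = ρ * (χ (P.label a) : ℂ) ^ r := by
  have : NeZero d := ⟨hd.ne'⟩
  -- No block is empty, so `∅` marks the zero block, where `f` separates the cycles. On the nonzero
  -- blocks the second component is a dummy.
  let key : Fin n → Finset (Fin n) × ℕ :=
    fun a => if a ∈ P.zeroBlock then (∅, f a) else (P.partition.part a, 0)
  have hkey0 : ∀ a ∈ P.zeroBlock, key a = (∅, f a) := fun a ha => if_pos ha
  have hkey1 : ∀ B ∈ P.partition.parts, ∀ a ∈ B, key a = (B, 0) := fun B hB a ha => by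
    change ite _ _ _ = _
    rw [if_neg (notMem_zeroBlock_of_mem hB ha), P.partition.part_eq_of_mem hB ha]
  have hkeyB : ∀ B ∈ P.partition.parts, ∀ b, key b = (B, 0) ↔ b ∈ B := by
    refine fun B hB b => ⟨fun h => ?_, hkey1 B hB b⟩
    by_cases hb : b ∈ P.zeroBlock
    · rw [hkey0 b hb, Prod.mk.injEq] at h
      exact absurd h.1.symm (P.partition.ne_empty hB)
    · obtain ⟨C, hC, hbC⟩ := exists_part_of_notMem hb
      rw [hkey1 C hC b hbC, Prod.mk.injEq] at h
      exact h.1 ▸ hbC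
  obtain ⟨σ, hσ, hσp⟩ := exists_perm_of_fibers key (fun a b => a ∉ P.zeroBlock →
      (χ (P.label b) : ℂ) ^ r = ρ * (χ (P.label a) : ℂ) ^ r) (by
    intro k
    by_cases hk : ∃ B ∈ P.partition.parts, k = (B, 0)
    · obtain ⟨B, hB, rfl⟩ := hk
      have hκ : IsPrimitiveRoot (ω ^ r) d := hω.pow (Nat.mul_pos hd hr) (mul_comm d r)
      have hcard : ∀ z, (Finset.univ.filter fun a : {a // key a = (B, 0)} =>
          (χ (P.label a.1) : ℂ) ^ r = z).card =
          (B.filter fun a => (χ (P.label a) : ℂ) ^ r = z).card := by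
        intro z
        refine Finset.card_bij (fun a _ => a.1) (fun a ha => ?_)
          (fun a _ b _ hab => Subtype.ext hab) fun b hb => ?_
        · exact Finset.mem_filter.2 ⟨(hkeyB B hB _).1 a.2, (Finset.mem_filter.1 ha).2⟩
        · obtain ⟨hb1, hb2⟩ := Finset.mem_filter.1 hb
          exact ⟨⟨b, (hkeyB B hB _).2 hb1⟩, Finset.mem_filter.2 ⟨Finset.mem_univ _, hb2⟩, rfl⟩
      obtain ⟨τ, hτ1, hτ2⟩ := exists_cyclic_perm (α := {a // key a = (B, 0)}) hd hρ
        (φ := fun a => (χ (P.label a.1) : ℂ) ^ r)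
        (fun a => by rw [hχ, pow_right_comm ω _ r, pow_right_comm (ω ^ r) _ d, hκ.pow_eq_one,
          one_pow])
        (fun i j => by
          obtain ⟨i', -, hi'⟩ := hκ.eq_pow_of_pow_eq_one (ξ := ρ ^ i) (by
            rw [pow_right_comm, hρ.pow_eq_one, one_pow])
          obtain ⟨j', -, hj'⟩ := hκ.eq_pow_of_pow_eq_one (ξ := ρ ^ j) (by
            rw [pow_right_comm, hρ.pow_eq_one, one_pow])
          rw [hcard, hcard, ← hi', ← hj']
          exact (isEvenlyColoured_iff hd hr hω hχ).1 hP B hB i' j')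
      exact ⟨τ, fun a _ => hτ1 a, hτ2⟩
    -- This fibre contains no point outside the zero block, so only cyclicity matters: a constant
    -- function with `d = 1` and `ρ = 1` suffices.
    · obtain ⟨τ, -, hτ⟩ := exists_cyclic_perm (α := {a // key a = k}) one_pos
        (ρ := 1) IsPrimitiveRoot.one (φ := fun _ => 1) (by simp) (by simp)
      refine ⟨τ, fun a ha => ?_, hτ⟩
      obtain ⟨B, hB, haB⟩ := exists_part_of_notMem ha
      exact absurd ⟨B, hB, a.2.symm.trans (hkey1 B hB _ haB)⟩ hk)
  refine ⟨σ, fun B hB a ha b => ?_, fun a ha b => ?_, hσp⟩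
  · rw [hσ, hkey1 B hB a ha, eq_comm, hkeyB B hB]
  · rw [hσ, hkey0 a ha]
    by_cases hb : b ∈ P.zeroBlock
    · simp [hkey0 b hb, hb]
    · obtain ⟨B, hB, hbB⟩ := exists_part_of_notMem hb
      rw [hkey1 B hB b hbB, Prod.mk.injEq]
      exact iff_of_false (fun h => P.partition.ne_empty hB h.1.symm) fun h => hb h.1

theorem GPrepartition.IsEvenlyColoured.exists_eigenspace_eq {r m d : ℕ} (hr : 0 < r) (hm : 0 < m)
    (hd : d = m / Nat.gcd m r) {ζ : ℂ} (hζ : IsPrimitiveRoot ζ m) {ω : ℂ}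
    (hω : IsPrimitiveRoot ω (d * r)) {χ : Multiplicative (ZMod (d * r)) →* ℂˣ}
    (hχ : ∀ g, (χ g : ℂ) = ω ^ (Multiplicative.toAdd g).val)
    {P : GPrepartition (Multiplicative (ZMod (d * r))) n} (hP : P.IsEvenlyColoured d)
    (f : Fin n → ℕ) {c : Fin n → ℂˣ} (hcr : ∀ a, c a ^ r = 1)
    (hc : ∀ a ∈ P.zeroBlock, ∏ b ∈ P.zeroBlock with f a = f b, (c b : ℂ) ≠
      ζ ^ (P.zeroBlock.filter fun b => f a = f b).card) :
    ∃ (θ : Fin n → ℂˣ) (σ : Equiv.Perm (Fin n)), (∀ i, θ i ^ r = 1) ∧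
      ∏ i, (θ i : ℂ) = ζ ^ (n - P.zeroBlock.card) * ∏ b ∈ P.zeroBlock, (c b : ℂ) ∧
      Module.End.eigenspace (Matrix.toLin' (monomialMatrix θ σ)) ζ = P.subspace χ := by
  have hζ0 : ζ ≠ 0 := hζ.ne_zero hm.ne'
  have hd0 : 0 < d := div_gcd_pos hm hd
  have hζr : IsPrimitiveRoot (ζ ^ r) d := hζ.pow_of_div_gcd hr hd
  obtain ⟨σ, hσB, hσI, hσχ⟩ := hP.exists_perm hr hd0 hζr.inv hω hχ f
  have hσ0 : ∀ a, a ∈ P.zeroBlock ↔ σ a ∈ P.zeroBlock := by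
    intro a
    have hsame : σ.SameCycle a (σ a) :=
      Equiv.Perm.sameCycle_apply_right.2 (Equiv.Perm.SameCycle.refl σ a)
    refine ⟨fun ha => ((hσI a ha _).1 hsame).1, fun ha => ((hσI _ ha _).1 hsame.symm).1⟩
  let θ : Fin n → ℂˣ := fun i => if i ∈ P.zeroBlock then c i else
    Units.mk0 ζ hζ0 * χ (P.label i) * (χ (P.label (σ.symm i)))⁻¹
  have hθ0 : ∀ i ∈ P.zeroBlock, θ i = c i := fun i hi => if_pos hi
  have hθ1 : ∀ a ∉ P.zeroBlock, (θ (σ a) : ℂ) * χ (P.label a) = ζ * χ (P.label (σ a)) := by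
    intro a ha
    have : θ (σ a) = Units.mk0 ζ hζ0 * χ (P.label (σ a)) * (χ (P.label a))⁻¹ := by
      change ite _ _ _ = _
      rw [if_neg ((hσ0 a).not.1 ha), Equiv.symm_apply_apply]
    rw [this, ← Units.val_mul, inv_mul_cancel_right]
    rfl
  have hle : P.subspace χ ≤ Module.End.eigenspace (Matrix.toLin' (monomialMatrix θ σ)) ζ := by
    rintro v ⟨hv0, hvB⟩
    rw [mem_eigenspace_monomialMatrix]
    intro a
    by_cases ha : a ∈ P.zeroBlock
    · rw [hv0 a ha, hv0 _ ((hσ0 a).1 ha), mul_zero, mul_zero]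
    · obtain ⟨B, hB, haB⟩ := exists_part_of_notMem ha
      have haB' : σ a ∈ B := (hσB B hB a haB _).1
        (Equiv.Perm.sameCycle_apply_right.2 (Equiv.Perm.SameCycle.refl σ a))
      refine mul_right_cancel₀ (χ (P.label a)).ne_zero ?_
      rw [mul_assoc ζ, ← hvB B hB a haB _ haB', mul_right_comm, hθ1 a ha]
      ring
  refine ⟨θ, σ, fun i => ?_, ?_, le_antisymm (fun v hv => ⟨fun a ha => ?_,
    fun B hB a ha b hb => ?_⟩) hle⟩
  · obtain ⟨a, rfl⟩ := σ.surjective i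
    by_cases ha : a ∈ P.zeroBlock
    · rw [hθ0 _ ((hσ0 a).1 ha), hcr]
    · apply Units.ext
      have h := congrArg (· ^ r) (hθ1 a ha)
      simp only [mul_pow] at h
      rw [hσχ a ha, mul_inv_cancel_left₀ (pow_ne_zero r hζ0)] at h
      rw [Units.val_pow_eq_pow_val, Units.val_one]
      -- The entry is an `r`-th root of unity because the factor `ζ ^ r` cancels the shift of the
      -- labels by `(ζ ^ r)⁻¹`.
      exact (mul_eq_right₀ (pow_ne_zero r (χ (P.label a)).ne_zero)).1 h
  · rw [← Finset.prod_mul_prod_compl P.zeroBlock, mul_comm]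
    congr 1
    · have h1 : ∏ i ∈ P.zeroBlockᶜ, (θ i : ℂ) = ∏ a ∈ P.zeroBlockᶜ, (θ (σ a) : ℂ) :=
        (Finset.prod_equiv σ (fun a => by simp only [Finset.mem_compl]; exact (hσ0 a).not)
          fun _ _ => rfl).symm
      have h2 : ∏ i ∈ P.zeroBlockᶜ, (χ (P.label i) : ℂ) =
          ∏ a ∈ P.zeroBlockᶜ, (χ (P.label (σ a)) : ℂ) :=
        (Finset.prod_equiv σ (fun a => by simp only [Finset.mem_compl]; exact (hσ0 a).not)
          fun _ _ => rfl).symm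
      have h3 := Finset.prod_congr rfl fun a ha => hθ1 a (Finset.mem_compl.1 ha)
      rw [Finset.prod_mul_distrib, Finset.prod_mul_distrib, Finset.prod_const, ← h1, ← h2,
        Finset.card_compl, Fintype.card_fin] at h3
      exact mul_right_cancel₀ (Finset.prod_ne_zero_iff.2 fun a _ => (χ _).ne_zero) h3
    · exact Finset.prod_congr rfl fun i hi => by rw [hθ0 i hi]
  -- An eigenvector nonzero at `a` is nonzero on its whole cycle, so the product of the entries
  -- there would be the value excluded by `hc`.
  · by_contra hva
    refine hc a ha ?_
    have hmem : ∀ b, b ∈ P.zeroBlock.filter (fun b => f a = f b) ↔ σ.SameCycle a b :=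
      fun b => by rw [Finset.mem_filter, hσI a ha]
    have hiff : ∀ b, b ∈ P.zeroBlock.filter (fun b => f a = f b) ↔
        σ b ∈ P.zeroBlock.filter (fun b => f a = f b) := fun b => by
      rw [hmem, hmem, Equiv.Perm.sameCycle_apply_right]
    rw [← prod_eq_pow_of_eigenvector hv hiff fun b hb hvb =>
      hva (eigenvector_eq_zero_of_sameCycle hζ0 hv ((hmem b).1 hb).symm hvb)]
    exact Finset.prod_congr rfl fun b hb => by rw [hθ0 b (Finset.mem_filter.1 hb).1]
  · have h := eigenvector_proportional hζ0 hv (hle (P.blockVector_mem_subspace χ hB))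
      ((hσB B hB a ha b).2 hb)
    rwa [P.blockVector_of_mem χ ha, P.blockVector_of_mem χ hb] at h

end Realisation

/-! ### The coset of `G(r, p, n)` and its symmetries. -/

section Coset

variable {n r p : ℕ}

/-- Multiplication by `diag(ξ, 1, …, 1)` multiplies the product of the entries by `ξ` and, since `ξ
^ r = 1`, keeps them `r`-th roots of unity. -/
theorem mem_matrixCoset_diagFirst (hn : 0 < n) (hr : 0 < r) {ξ : ℂ} (hξ : ξ ^ r = 1)
    {x : Matrix (Fin n) (Fin n) ℂ} :
    x ∈ matrixCoset (diagFirst n ξ) (imprimitiveGroup r p n) ↔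
      ∃ (θ : Fin n → ℂˣ) (σ : Equiv.Perm (Fin n)), (∀ i, θ i ^ r = 1) ∧
        (∏ i, (θ i : ℂ)) ^ (r / p) = ξ ^ (r / p) ∧ x = monomialMatrix θ σ := by
  have hξ0 : ξ ≠ 0 := ne_zero_of_pow_eq_one_of_pos hr hξ
  let u : ℂˣ := Units.mk0 ξ hξ0
  have hu : u ^ r = 1 := Units.ext (by rw [Units.val_pow_eq_pow_val]; exact hξ)
  let δ : Fin n → ℂˣ := fun i => if i = ⟨0, hn⟩ then u else 1
  have hδr : ∀ i, δ i ^ r = 1 := fun i => by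
    change (ite _ _ _) ^ r = _
    split_ifs
    · exact hu
    · exact one_pow r
  have hδ : ∏ i, δ i = u := by simp [δ]
  have hdiag : diagFirst n ξ = monomialMatrix δ 1 := by
    ext i j
    by_cases hij : i = j
    · subst hij
      by_cases hi : i = ⟨0, hn⟩
      · simp [diagFirst, monomialMatrix, δ, hi, u]
      · have hi' : (i : ℕ) ≠ 0 := fun h => hi (Fin.ext h)
        simp [diagFirst, monomialMatrix, δ, hi, hi']
    · simp [diagFirst, monomialMatrix, hij]
  have hcoe : ∀ θ : Fin n → ℂˣ, ((∏ i, θ i : ℂˣ) : ℂ) = ∏ i, (θ i : ℂ) := fun θ =>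
    Units.coe_prod θ Finset.univ
  constructor
  · rintro ⟨g, ⟨θ, σ, h1, h2, h3⟩, rfl⟩
    refine ⟨fun i => δ i * θ i, σ, fun i => by rw [mul_pow, hδr, h1, one_mul], ?_, ?_⟩
    · rw [← hcoe, Finset.prod_mul_distrib, hδ, ← Units.val_pow_eq_pow_val, mul_pow, h2, mul_one,
        Units.val_pow_eq_pow_val]
      rfl
    · rw [h3, hdiag, monomialMatrix_mul, one_mul]
      rfl
  · rintro ⟨θ, σ, h1, h2, rfl⟩
    have hmul : ∀ (θ : Fin n → ℂˣ) (σ : Equiv.Perm (Fin n)),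
        monomialMatrix θ σ * monomialMatrix (fun i => (θ (σ i))⁻¹) σ⁻¹ = 1 := fun θ σ => by
      rw [monomialMatrix_mul, ← monomialMatrix_one]
      simp
    let θ' : Fin n → ℂˣ := fun i => (δ i)⁻¹ * θ i
    refine ⟨⟨monomialMatrix θ' σ, _, hmul θ' σ, mul_eq_one_comm.1 (hmul θ' σ)⟩,
      ⟨θ', σ, fun i => ?_, ?_, rfl⟩, ?_⟩
    · rw [mul_pow, inv_pow, hδr, h1, inv_one, one_mul]
    · have h2' : (∏ i, θ i) ^ (r / p) = u ^ (r / p) :=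
        Units.ext (by rw [Units.val_pow_eq_pow_val, hcoe, h2]; rfl)
      rw [Finset.prod_mul_distrib, Finset.prod_inv_distrib, hδ, mul_pow, h2', inv_pow,
        inv_mul_cancel]
    · change _ = _ * monomialMatrix θ' σ
      have h : (fun i => δ i * θ' ((1 : Equiv.Perm (Fin n)).symm i)) = θ :=
        funext fun i => mul_inv_cancel_left _ _
      rw [hdiag, monomialMatrix_mul, h, one_mul]

/-- The set of eigenspaces is stable under the action of `G(r, 1, n)`. -/
theorem exists_mem_eigenspace_of_conj (hn : 0 < n) (hr : 0 < r) {ξ : ℂ} (hξ : ξ ^ r = 1) {ζ : ℂ}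
    {x : Matrix (Fin n) (Fin n) ℂ}
    (hx : x ∈ matrixCoset (diagFirst n ξ) (imprimitiveGroup r p n)) {v : Fin n → ℂ}
    (hv : v ∈ Module.End.eigenspace (Matrix.toLin' x) ζ) {δ : Fin n → ℂˣ}
    (hδ : ∀ i, δ i ^ r = 1) (τ : Equiv.Perm (Fin n)) :
    ∃ y ∈ matrixCoset (diagFirst n ξ) (imprimitiveGroup r p n),
      (fun i => (δ i : ℂ) * v (τ.symm i)) ∈ Module.End.eigenspace (Matrix.toLin' y) ζ := by
  obtain ⟨θ, σ, h1, h2, rfl⟩ := (mem_matrixCoset_diagFirst hn hr hξ).1 hx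
  let σ' : Equiv.Perm (Fin n) := τ * σ * τ⁻¹
  let θ' : Fin n → ℂˣ := fun i => δ i * θ (τ.symm i) * (δ (σ'.symm i))⁻¹
  refine ⟨monomialMatrix θ' σ', (mem_matrixCoset_diagFirst hn hr hξ).2
    ⟨θ', σ', fun i => ?_, ?_, rfl⟩, ?_⟩
  · rw [mul_pow, mul_pow, inv_pow, hδ, hδ, h1, inv_one, one_mul, one_mul]
  · have : ∏ i, θ' i = ∏ i, θ i := by
      rw [Finset.prod_mul_distrib, Finset.prod_mul_distrib, Finset.prod_inv_distrib,
        Equiv.prod_comp σ'.symm δ, Equiv.prod_comp τ.symm θ, mul_comm, inv_mul_cancel_left]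
    rw [← Units.coe_prod, this, Units.coe_prod, h2]
  · rw [mem_eigenspace_monomialMatrix] at hv ⊢
    intro i
    have h := hv (τ.symm i)
    have e1 : τ.symm (σ' i) = σ (τ.symm i) := by simp [σ']
    have e2 : (θ' (σ' i) : ℂ) * δ i = δ (σ' i) * θ (σ (τ.symm i)) := by
      rw [← Units.val_mul, ← Units.val_mul]
      simp only [θ', Equiv.symm_apply_apply, inv_mul_cancel_right, e1]
    rw [← mul_assoc, e2, mul_assoc, h, e1]
    ring

end Coset

/-! ### Realisation inside the coset, and least eigenspaces. -/

section Realisation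

variable {n r p m d : ℕ}

/-- Here `t` is the product of all entries. The nonzero blocks contribute `ζ ^ (n - |I|)`, so the
entries on the zero block `I` must have product `u = t / ζ ^ (n - |I|)`. A single cycle on `I` works
when `u ≠ ζ ^ |I|`, that is `t ≠ ζ ^ n`. If `t = ζ ^ n`, two cycles are used, which needs two points
and some `c ≠ ζ`. -/
theorem GPrepartition.IsEvenlyColoured.exists_mem_coset {ξ : ℂ} (hn : 0 < n) (hr : 0 < r)
    (hm : 0 < m) (hd : d = m / Nat.gcd m r) (hξ : ξ ^ r = 1) {ζ : ℂ} (hζ : IsPrimitiveRoot ζ m)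
    {ω : ℂ} (hω : IsPrimitiveRoot ω (d * r)) {χ : Multiplicative (ZMod (d * r)) →* ℂˣ}
    (hχ : ∀ g, (χ g : ℂ) = ω ^ (Multiplicative.toAdd g).val)
    {P : GPrepartition (Multiplicative (ZMod (d * r))) n} (hP : P.IsEvenlyColoured d)
    {t : ℂ} (htr : t ^ r = 1) (htp : t ^ (r / p) = ξ ^ (r / p))
    (h : (P.zeroBlock = ∅ ∧ t = ζ ^ n) ∨ (P.zeroBlock.Nonempty ∧ t ≠ ζ ^ n) ∨
      (1 < P.zeroBlock.card ∧ t = ζ ^ n ∧ ∃ c : ℂ, c ^ r = 1 ∧ c ≠ ζ)) :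
    ∃ x ∈ matrixCoset (diagFirst n ξ) (imprimitiveGroup r p n),
      P.subspace χ = Module.End.eigenspace (Matrix.toLin' x) ζ := by
  have hζ0 : ζ ≠ 0 := hζ.ne_zero hm.ne'
  have hd0 : 0 < d := div_gcd_pos hm hd
  have hζr : IsPrimitiveRoot (ζ ^ r) d := hζ.pow_of_div_gcd hr hd
  have hcard : P.zeroBlock.card ≤ n := by simpa using Finset.card_le_univ P.zeroBlock
  have hdvd := (hP.isDivisible hd0).dvd_sub_card
  have ht0 : t ≠ 0 := ne_zero_of_pow_eq_one_of_pos hr htr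
  suffices H : ∃ (f : Fin n → ℕ) (c : Fin n → ℂˣ), (∀ a, c a ^ r = 1) ∧
      ζ ^ (n - P.zeroBlock.card) * ∏ b ∈ P.zeroBlock, (c b : ℂ) = t ∧
      ∀ a ∈ P.zeroBlock, ∏ b ∈ P.zeroBlock with f a = f b, (c b : ℂ) ≠
        ζ ^ (P.zeroBlock.filter fun b => f a = f b).card by
    obtain ⟨f, c, hcr, hct, hc⟩ := H
    obtain ⟨θ, σ, h1, h2, h3⟩ := hP.exists_eigenspace_eq hr hm hd hζ hω hχ f hcr hc
    exact ⟨_, (mem_matrixCoset_diagFirst hn hr hξ).2 ⟨θ, σ, h1, by rw [h2, hct, htp], rfl⟩,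
      h3.symm⟩
  let s : ℂˣ := Units.mk0 ζ hζ0 ^ (n - P.zeroBlock.card)
  have hs : (s : ℂ) = ζ ^ (n - P.zeroBlock.card) := Units.val_pow_eq_pow_val _ _
  have hsr : s ^ r = 1 := by
    apply Units.ext
    rw [Units.val_pow_eq_pow_val, hs, pow_right_comm, Units.val_one]
    exact (hζr.pow_eq_one_iff_dvd _).2 hdvd
  have hsn : (s : ℂ) * ζ ^ P.zeroBlock.card = ζ ^ n := by
    rw [hs, ← pow_add, Nat.sub_add_cancel hcard]
  let u : ℂˣ := s⁻¹ * Units.mk0 t ht0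
  have hu : (s : ℂ) * u = t := by
    rw [← Units.val_mul, mul_inv_cancel_left]
    rfl
  have hur : u ^ r = 1 := by
    rw [mul_pow, inv_pow, hsr, inv_one, one_mul]
    exact Units.ext (by rw [Units.val_pow_eq_pow_val]; exact htr)
  rw [← hs]
  rcases h with ⟨h0, ht⟩ | ⟨⟨a₀, ha₀⟩, ht⟩ | ⟨h1, ht, c, hcr, hcζ⟩
  · refine ⟨fun _ => 0, fun _ => 1, fun _ => one_pow r, ?_, fun a ha => ?_⟩
    · rw [h0, Finset.prod_empty, mul_one, hs, h0, Finset.card_empty, Nat.sub_zero, ht]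
    · rw [h0] at ha
      exact absurd ha (Finset.notMem_empty a)
  · have hprod : ∏ b ∈ P.zeroBlock, (((if b = a₀ then u else 1 : ℂˣ)) : ℂ) = u := by
      rw [← Units.coe_prod, Finset.prod_ite_eq', if_pos ha₀]
    refine ⟨fun _ => 0, fun a => if a = a₀ then u else 1, fun a => ?_, by rw [hprod, hu],
      fun a _ => ?_⟩
    · beta_reduce
      split_ifs
      · exact hur
      · exact one_pow r
    · simp only [Finset.filter_true]
      rw [hprod]
      exact fun h => ht (by rw [← hu, h, hsn])
  · obtain ⟨a₁, h₁, a₂, h₂, hne⟩ := Finset.one_lt_card.1 h1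
    have hc0 : c ≠ 0 := ne_zero_of_pow_eq_one_of_pos hr hcr
    let w : ℂˣ := Units.mk0 c hc0
    have hwr : w ^ r = 1 := Units.ext (by rw [Units.val_pow_eq_pow_val]; exact hcr)
    have hrest : ∏ b ∈ P.zeroBlock.erase a₁,
        ((if b = a₁ then w else if b = a₂ then w⁻¹ * u else 1 : ℂˣ) : ℂ) =
          (w⁻¹ * u : ℂˣ) := by
      rw [Finset.prod_congr rfl fun b hb => by rw [if_neg (Finset.ne_of_mem_erase hb)],
        ← Units.coe_prod, Finset.prod_ite_eq',
        if_pos (Finset.mem_erase.2 ⟨hne.symm, h₂⟩)]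
    -- The cycles are `{a₁}`, with product `c`, and the rest of the zero block, with product `u /
    -- c`. If the second product were the bad one, then `u = ζ ^ |I|` would give `c = ζ`.
    refine ⟨fun b => if b = a₁ then 0 else 1,
      fun b => if b = a₁ then w else if b = a₂ then w⁻¹ * u else 1, fun a => ?_, ?_,
      fun a ha => ?_⟩
    · beta_reduce
      split_ifs
      · exact hwr
      · rw [mul_pow, inv_pow, hwr, hur, inv_one, one_mul]
      · exact one_pow r
    · rw [← Finset.mul_prod_erase _ _ h₁, hrest]
      beta_reduce
      rw [if_pos rfl, ← Units.val_mul,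
        mul_inv_cancel_left, hu]
    · by_cases haa : a = a₁
      · have hf : (P.zeroBlock.filter fun b =>
            (if a = a₁ then 0 else 1) = if b = a₁ then 0 else 1) = {a₁} := by
          ext b
          by_cases hb : b = a₁ <;> simp [haa, hb, h₁]
        rw [hf, Finset.prod_singleton]
        beta_reduce
        rw [if_pos rfl, Finset.card_singleton, pow_one]
        exact hcζ
      · have hf : (P.zeroBlock.filter fun b =>
            (if a = a₁ then 0 else 1) = if b = a₁ then 0 else 1) = P.zeroBlock.erase a₁ := by
          ext b
          by_cases hb : b = a₁ <;> simp [haa, hb]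
        rw [hf, hrest]
        intro h
        have h2 : (u : ℂ) = c * ζ ^ (P.zeroBlock.erase a₁).card := by
          rw [← h]
          exact congrArg Units.val (mul_inv_cancel_left w u).symm
        have h3 : (u : ℂ) = ζ ^ P.zeroBlock.card := by
          apply mul_left_cancel₀ s.ne_zero
          rw [hu, hsn, ht]
        rw [h3, ← Finset.card_erase_add_one h₁, pow_succ'] at h2
        exact hcζ (mul_right_cancel₀ (pow_ne_zero _ hζ0) h2).symm

/-- Apart from the exceptional case, a nonzero eigenspace does not contain all the others, provided
that it is proper or `d > 1`. -/
theorem GPrepartition.IsEvenlyColoured.not_forall_eigenspace_le {ξ : ℂ} (hn : 1 < n) (hr : 0 < r)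
    (hm : 0 < m) (hd : d = m / Nat.gcd m r) (hξ : ξ ^ r = 1) {ζ : ℂ}
    {ω : ℂ} (hω : IsPrimitiveRoot ω (d * r)) {χ : Multiplicative (ZMod (d * r)) →* ℂˣ}
    (hχi : Function.Injective χ)
    {P : GPrepartition (Multiplicative (ZMod (d * r))) n} (hP : P.IsEvenlyColoured d)
    (hPX : ∃ x ∈ matrixCoset (diagFirst n ξ) (imprimitiveGroup r p n),
      P.subspace χ = Module.End.eigenspace (Matrix.toLin' x) ζ)
    (hP1 : P.zeroBlock ≠ Finset.univ) (hPd : P.zeroBlock.Nonempty ∨ 1 < d)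
    (hex : ¬ (n = 2 ∧ r = 1 ∧ m = 2)) :
    ¬ ∀ x ∈ matrixCoset (diagFirst n ξ) (imprimitiveGroup r p n),
      Module.End.eigenspace (Matrix.toLin' x) ζ ≤ P.subspace χ := by
  intro hmax
  have hd0 : 0 < d := div_gcd_pos hm hd
  obtain ⟨x, hx, hxP⟩ := hPX
  -- A largest eigenspace is stable under `G(r, 1, n)`, since conjugation permutes the eigenspaces.
  have hinv : ∀ (δ : Fin n → ℂˣ), (∀ i, δ i ^ r = 1) → ∀ (τ : Equiv.Perm (Fin n)) v,
      v ∈ P.subspace χ → (fun i => (δ i : ℂ) * v (τ.symm i)) ∈ P.subspace χ := by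
    intro δ hδ τ v hv
    obtain ⟨y, hy, hyv⟩ := exists_mem_eigenspace_of_conj (by omega) hr hξ hx (hxP ▸ hv) hδ τ
    exact hmax y hy hyv
  have hswap : ∀ (a b : Fin n) v, v ∈ P.subspace χ → v ∘ Equiv.swap a b ∈ P.subspace χ := by
    intro a b v hv
    have h := hinv (fun _ => 1) (fun _ => one_pow r) (Equiv.swap a b) v hv
    simpa [Function.comp_def] using h
  obtain ⟨a₀, ha₀⟩ : ∃ a, a ∉ P.zeroBlock := by
    by_contra! h
    exact hP1 (Finset.eq_univ_iff_forall.2 h)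
  obtain ⟨B, hB, ha₀B⟩ := exists_part_of_notMem ha₀
  have hv := P.blockVector_mem_subspace χ hB
  -- A transposition carries the nonzero coordinate `a₀` of the block vector to `c`.
  have hI : ∀ c, c ∉ P.zeroBlock := by
    intro c hc
    have h := (hswap a₀ c _ hv).1 c hc
    rw [Function.comp_apply, Equiv.swap_apply_right] at h
    exact blockVector_apply_ne_zero.2 ha₀B h
  have hd1 : 1 < d := hPd.resolve_left fun ⟨c, hc⟩ => hI c hc
  have hBcard : d ∣ B.card := hP.isDivisible hd0 B hB
  -- Since `d > 1` divides `|B|`, there is a second point `b` in `B`. Swapping `a₀` with a point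
  -- outside `B` would give a vector of the subspace that vanishes at `a₀` but not at `b`.
  have hBu : ∀ c, c ∈ B := by
    intro c
    by_contra hc
    obtain ⟨b, hb, hba⟩ := Finset.exists_mem_ne
      (hd1.trans_le (Nat.le_of_dvd (Finset.card_pos.2 ⟨a₀, ha₀B⟩) hBcard)) a₀
    have h := (hswap a₀ c _ hv).2 B hB a₀ ha₀B b hb
    rw [Function.comp_apply, Function.comp_apply, Equiv.swap_apply_left,
      Equiv.swap_apply_of_ne_of_ne hba (fun h : b = c => hc (h ▸ hb)), P.blockVector_of_notMem χ hc,
      zero_mul] at h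
    exact mul_ne_zero (blockVector_apply_ne_zero.2 hb) (χ _).ne_zero h.symm
  have hBn : B.card = n := by
    rw [Finset.eq_univ_iff_forall.2 hBu, Finset.card_univ, Fintype.card_fin]
  have hne : ∀ a, (χ (P.label a) : ℂ) ≠ 0 := fun a => (χ _).ne_zero
  rcases Nat.lt_or_ge 2 n with hn3 | hn2
  -- A third coordinate `c` serves as reference when `a` and `b` are swapped. Constant labels then
  -- contradict even colouring with `d > 1`.
  · have hlab : ∀ a b, P.label a = P.label b := by
      intro a b
      obtain ⟨c, hc⟩ : ∃ c, c ∉ ({a, b} : Finset (Fin n)) := by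
        by_contra! h
        have h1 := Finset.card_le_two (a := a) (b := b)
        rw [Finset.eq_univ_iff_forall.2 h, Finset.card_univ, Fintype.card_fin] at h1
        omega
      simp only [Finset.mem_insert, Finset.mem_singleton, not_or] at hc
      have h := (hswap a b _ hv).2 B hB a (hBu a) c (hBu c)
      rw [Function.comp_apply, Function.comp_apply, Equiv.swap_apply_left,
        Equiv.swap_apply_of_ne_of_ne hc.1 hc.2, P.blockVector_of_mem χ (hBu b),
        P.blockVector_of_mem χ (hBu c), mul_comm] at h
      exact hχi (Units.ext (mul_left_cancel₀ (hne c) h)).symm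
    have h := hP.card_eq hd0 hB (Multiplicative.toAdd (P.label a₀)).val
    rw [Finset.filter_true_of_mem fun a _ => by rw [hlab a a₀], hBn] at h
    nlinarith
  · have hn2 : n = 2 := by omega
    rw [hBn, hn2] at hBcard
    have hd2 : d = 2 := by
      have := Nat.le_of_dvd two_pos hBcard
      omega
    have hr1 : 1 < r := by
      by_contra h
      have hr1 : r = 1 := by omega
      refine hex ⟨hn2, hr1, ?_⟩
      rw [← hd2, hd, hr1, Nat.gcd_one_right, Nat.div_one]
    -- For `n = 2` transpositions do not suffice. The diagonal matrix with one entry a primitive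
    -- `r`-th root of unity, where `r > 1`, moves the line.
    have hωd : IsPrimitiveRoot (ω ^ d) r := hω.pow (Nat.mul_pos hd0 hr) rfl
    let u : ℂˣ := Units.mk0 (ω ^ d) (hωd.ne_zero hr.ne')
    have hur : u ^ r = 1 := Units.ext (by rw [Units.val_pow_eq_pow_val]; exact hωd.pow_eq_one)
    obtain ⟨b, hb⟩ : ∃ b : Fin n, b ≠ a₀ := by
      have : Nontrivial (Fin n) := Fin.nontrivial_iff_two_le.2 hn
      exact exists_ne a₀
    have h := (hinv (fun i => if i = a₀ then u else 1) (fun i => by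
      split_ifs
      · exact hur
      · exact one_pow r) (Equiv.refl _) _ hv).2 B hB a₀ (hBu a₀) b (hBu b)
    simp only [if_neg hb, if_true, Units.val_one, one_mul, Equiv.refl_symm,
      Equiv.refl_apply, P.blockVector_of_mem χ (hBu _)] at h
    rw [mul_assoc, mul_comm (χ (P.label b) : ℂ)] at h
    exact hωd.ne_one hr1 (mul_right_cancel₀ (mul_ne_zero (hne a₀) (hne b))
      (h.trans (one_mul _).symm))

end Realisation

/-! ### Dowling lattices of the trivial group and partition lattices. -/

theorem Finpartition.le_iff_part_eq {n : ℕ} {π π' : PartitionLattice n} :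
    π ≤ π' ↔ ∀ a b, π.part a = π.part b → π'.part a = π'.part b := by
  have hmem : ∀ (π : PartitionLattice n) a b, a ∈ π.part b ↔ π.part a = π.part b := fun π a b =>
    π.mem_part_iff_part_eq_part (Finset.mem_univ _) (Finset.mem_univ _)
  constructor
  · intro h a b hab
    obtain ⟨C, hC, hBC⟩ := h (π.part_mem.2 (Finset.mem_univ b))
    have ha := hBC ((hmem π a b).2 hab)
    have hb := hBC ((hmem π b b).2 rfl)
    rw [π'.part_eq_of_mem hC ha, π'.part_eq_of_mem hC hb]
  · intro h B hB
    obtain ⟨b, hb⟩ := π.nonempty_of_mem_parts hB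
    refine ⟨π'.part b, π'.part_mem.2 (Finset.mem_univ b), fun a ha => (hmem π' a b).2 (h a b ?_)⟩
    rw [π.part_eq_of_mem hB ha, π.part_eq_of_mem hB hb]

open Classical in
theorem exists_partitionLattice_ker {n : ℕ} {β : Type*} (h : Fin n → β) :
    ∃ π : PartitionLattice n, ∀ a b, π.part a = π.part b ↔ h a = h b := by
  refine ⟨Finpartition.ofSetoid (Setoid.ker h), fun a b => ?_⟩
  rw [← Finpartition.mem_part_iff_part_eq_part _ (Finset.mem_univ _) (Finset.mem_univ _),
    Finpartition.mem_part_ofSetoid_iff_rel]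
  exact eq_comm

namespace GPrepartition

/-- The block of an element, shifted by one; `0` and all elements of the zero block are sent
to `∅`. -/
def blockOf {G : Type*} {n : ℕ} (P : GPrepartition G n) : Fin (n + 1) → Finset (Fin n) :=
  Fin.cases ∅ P.partition.part

theorem blockOf_succ {G : Type*} {n : ℕ} (P : GPrepartition G n) (a : Fin n) :
    P.blockOf a.succ = P.partition.part a := rfl

theorem part_eq_empty_iff {G : Type*} {n : ℕ} {P : GPrepartition G n} {a : Fin n} :
    P.partition.part a = ∅ ↔ a ∈ P.zeroBlock := by
  rw [Finpartition.part_eq_empty, Finset.mem_compl, not_not]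

/-- Without labels, a prepartition of `n` points is a partition of `n + 1` points: the extra point
`0` joins the zero block. It is encoded as the kernel of `blockOf`, where the value `∅` is free
because parts are nonempty. -/
theorem refines_iff_blockOf {G : Type*} [Group G] [Subsingleton G] {n : ℕ}
    {P Q : GPrepartition G n} :
    P.Refines Q ↔ ∀ i j, P.blockOf i = P.blockOf j → Q.blockOf i = Q.blockOf j := by
  constructor
  · intro h
    have key0 : ∀ a, P.partition.part a = ∅ → Q.partition.part a = ∅ := fun a ha =>
      part_eq_empty_iff.2 (h.1 (part_eq_empty_iff.1 ha))
    have key : ∀ a b, P.partition.part a = P.partition.part b →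
        Q.partition.part a = Q.partition.part b := by
      intro a b hab
      by_cases ha : a ∈ P.zeroBlock
      · have ha' := part_eq_empty_iff.2 ha
        rw [key0 a ha', key0 b (hab ▸ ha')]
      · obtain ⟨B, hB, haB⟩ := exists_part_of_notMem ha
        have hpa := P.partition.part_eq_of_mem hB haB
        have hbB : b ∈ B := (P.partition.part_eq_iff_mem hB).1 (hab ▸ hpa)
        rcases h.2 B hB with h' | ⟨C, hC, hBC, -⟩
        · rw [part_eq_empty_iff.2 (h' haB), part_eq_empty_iff.2 (h' hbB)]
        · rw [Q.partition.part_eq_of_mem hC (hBC haB), Q.partition.part_eq_of_mem hC (hBC hbB)]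
    intro i j
    induction i using Fin.cases with
    | zero =>
      induction j using Fin.cases with
      | zero => exact fun _ => rfl
      | succ b => exact fun hb => (key0 b hb.symm).symm
    | succ a =>
      induction j using Fin.cases with
      | zero => exact key0 a
      | succ b => exact key a b
  · intro h
    refine ⟨fun a ha => part_eq_empty_iff.1 (h a.succ 0 (part_eq_empty_iff.2 ha)),
      fun B hB => ?_⟩
    obtain ⟨a, ha⟩ := P.partition.nonempty_of_mem_parts hB
    have hQ : ∀ b ∈ B, Q.partition.part b = Q.partition.part a := fun b hb =>
      h b.succ a.succ (by
        rw [blockOf_succ, blockOf_succ, P.partition.part_eq_of_mem hB ha,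
          P.partition.part_eq_of_mem hB hb])
    by_cases haQ : a ∈ Q.zeroBlock
    · exact Or.inl fun b hb => part_eq_empty_iff.1 ((hQ b hb).trans (part_eq_empty_iff.2 haQ))
    · obtain ⟨C, hC, haC⟩ := exists_part_of_notMem haQ
      exact Or.inr ⟨C, hC, fun b hb => (Q.partition.part_eq_iff_mem hC).1
        ((hQ b hb).trans (Q.partition.part_eq_of_mem hC haC)), 1,
        fun _ _ => Subsingleton.elim _ _⟩

end GPrepartition

section PartitionLattice

open GPrepartition hiding mk
open DowlingLattice

/-- The Dowling lattice of the trivial group is a partition lattice. -/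
theorem nonempty_dowlingLattice_orderIso_partitionLattice {G : Type*} [Group G] [Subsingleton G]
    (k : ℕ) : Nonempty (DowlingLattice G k ≃o PartitionLattice (k + 1)) := by
  choose rep hrep using mk_surjective (G := G) (n := k)
  choose f hf using fun x : DowlingLattice G k => exists_partitionLattice_ker (rep x).blockOf
  have hle : ∀ x y, f x ≤ f y ↔ x ≤ y := by
    intro x y
    rw [Finpartition.le_iff_part_eq]
    simp only [hf]
    rw [← refines_iff_blockOf, ← mk_le_mk, hrep, hrep]
  refine ⟨OrderIso.ofRelIsoLT (RelIso.ofSurjective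
    (OrderEmbedding.ofMapLEIff f hle).ltEmbedding fun π => ?_)⟩
  obtain ⟨P, hP0, -, hPB⟩ := exists_of_setoid (G := G)
    (Finset.univ.filter fun a : Fin k => π.part a.succ = π.part 0)
    (Setoid.ker fun a : Fin k => π.part a.succ) fun _ => 1
  have h0 : ∀ a : Fin k, P.partition.part a = ∅ ↔ π.part a.succ = π.part 0 := fun a => by
    rw [part_eq_empty_iff, hP0, Finset.mem_filter, and_iff_right (Finset.mem_univ _)]
  have h1 : ∀ a b : Fin k, P.partition.part a = P.partition.part b ↔
      π.part a.succ = π.part b.succ := by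
    intro a b
    by_cases ha : P.partition.part a = ∅
    · rw [ha, (h0 a).1 ha, eq_comm, h0, eq_comm]
    · obtain ⟨B, hB, haB⟩ := exists_part_of_notMem fun h => ha (part_eq_empty_iff.2 h)
      obtain ⟨c, -, hc⟩ := (hPB B).1 hB
      rw [P.partition.part_eq_of_mem hB haB, eq_comm, P.partition.part_eq_iff_mem hB, hc b]
      have hca : π.part c.succ = π.part a.succ := ((hc a).1 haB).2
      have hs : (Setoid.ker fun a : Fin k => π.part a.succ) c b ↔
        π.part c.succ = π.part b.succ := Iff.rfl
      rw [hs, hca, and_iff_right_iff_imp]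
      intro hab hb
      rw [Finset.mem_filter] at hb
      exact ha ((h0 a).2 (hab.trans hb.2))
  have hker : ∀ i j, P.blockOf i = P.blockOf j ↔ π.part i = π.part j := by
    intro i j
    induction i using Fin.cases with
    | zero =>
      induction j using Fin.cases with
      | zero => exact iff_of_true rfl rfl
      | succ b => exact eq_comm.trans ((h0 b).trans eq_comm)
    | succ a =>
      induction j using Fin.cases with
      | zero => exact h0 a
      | succ b => exact h1 a b
  have hblock : ∀ i j, (rep (mk P)).blockOf i = (rep (mk P)).blockOf j ↔
      P.blockOf i = P.blockOf j := fun i j =>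
    ⟨refines_iff_blockOf.1 (mk_le_mk.1 (hrep (mk P)).le) i j,
      refines_iff_blockOf.1 (mk_le_mk.1 (hrep (mk P)).ge) i j⟩
  refine ⟨mk P, le_antisymm ?_ ?_⟩ <;> refine Finpartition.le_iff_part_eq.2 fun i j hij => ?_
  · exact (hker i j).1 ((hblock i j).1 ((hf (mk P) i j).1 hij))
  · exact (hf (mk P) i j).2 ((hblock i j).2 ((hker i j).2 hij))

/-- For a trivial group, the elements of the Dowling lattice with empty zero block form a copy of
the partition lattice. -/
theorem exists_partitionLattice_orderEmbedding (G : Type*) [Group G] [Subsingleton G] (n : ℕ) :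
    ∃ J : PartitionLattice n ↪o DowlingLattice G n,
      ∀ P : GPrepartition G n, (∃ π, J π = mk P) ↔ P.zeroBlock = ∅ := by
  let f : PartitionLattice n → GPrepartition G n :=
    fun π => ⟨∅, π.copy Finset.compl_empty.symm, fun _ => 1⟩
  have hf : ∀ π π', mk (f π) ≤ mk (f π') ↔ π ≤ π' := by
    intro π π'
    rw [mk_le_mk]
    constructor
    · intro h B hB
      rcases h.2 B hB with h' | ⟨C, hC, hBC, -⟩
      · exact absurd (Finset.subset_empty.1 h') (π.ne_empty hB)
      · exact ⟨C, hC, hBC⟩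
    · intro h
      refine ⟨subset_rfl, fun B hB => Or.inr ?_⟩
      obtain ⟨C, hC, hBC⟩ := h hB
      exact ⟨C, hC, hBC, 1, fun _ _ => Subsingleton.elim _ _⟩
  refine ⟨OrderEmbedding.ofMapLEIff (fun π => mk (f π)) hf, fun P => ⟨?_, fun hP => ?_⟩⟩
  · rintro ⟨π, hπ⟩
    exact (mk_eq_mk.1 hπ).1.symm
  · refine ⟨P.partition.copy (by rw [hP, Finset.compl_empty]), mk_eq_mk.2 ⟨hP.symm, rfl,
      fun B _ => ⟨1, fun _ _ => Subsingleton.elim _ _⟩⟩⟩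

end PartitionLattice

/-! ### Zero blocks of size one. -/

section ZeroBlock

variable {n : ℕ} {θ : Fin n → ℂˣ} {σ : Equiv.Perm (Fin n)} {ζ : ℂ} {v : Fin n → ℂ}

/-- If the product of the entries of a monomial matrix is `ζⁿ`, then the eigenvectors for `ζ` do
not vanish on exactly one coordinate. -/
theorem exists_eigenvector_apply_ne_zero (hζ : ζ ≠ 0)
    (hv : v ∈ Module.End.eigenspace (Matrix.toLin' (monomialMatrix θ σ)) ζ)
    (hθ : ∏ a, (θ a : ℂ) = ζ ^ n) {a₀ : Fin n} (h0 : ∀ a, v a = 0 ↔ a = a₀) :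
    ∃ u ∈ Module.End.eigenspace (Matrix.toLin' (monomialMatrix θ σ)) ζ, u a₀ ≠ 0 := by
  have hσ0 : σ a₀ = a₀ := (h0 _).1 (eigenvector_eq_zero_of_sameCycle hζ hv
    (Equiv.Perm.sameCycle_apply_right.2 (Equiv.Perm.SameCycle.refl σ a₀)) ((h0 _).2 rfl))
  have hσ : ∀ a, σ a = a₀ ↔ a = a₀ := fun a =>
    ⟨fun h => σ.injective (h.trans hσ0.symm), fun h => h ▸ hσ0⟩
  have h1 := prod_eq_pow_of_eigenvector hv (S := Finset.univ.erase a₀) (by simp [hσ])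
    (fun a ha h => Finset.ne_of_mem_erase ha ((h0 a).1 h))
  -- The other coordinates account for `ζ ^ (n - 1)`, so the entry at the fixed point `a₀` is `ζ`,
  -- and the basis vector there is an eigenvector.
  have h2 : (θ a₀ : ℂ) = ζ := by
    rw [← Finset.mul_prod_erase _ _ (Finset.mem_univ a₀), h1] at hθ
    have hc := Finset.card_erase_add_one (Finset.mem_univ a₀)
    rw [Finset.card_univ, Fintype.card_fin] at hc
    refine mul_right_cancel₀ (pow_ne_zero (Finset.univ.erase a₀).card hζ) ?_
    rw [hθ, ← pow_succ', hc]
  refine ⟨Pi.single a₀ 1, mem_eigenspace_monomialMatrix.2 fun a => ?_, by simp⟩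
  by_cases ha : a = a₀
  · rw [ha, hσ0, h2]
  · rw [Pi.single_eq_of_ne ha, Pi.single_eq_of_ne ((hσ a).not.2 ha), mul_zero, mul_zero]

end ZeroBlock

/-! ### From a condition on prepartitions to the isomorphism. -/

section Assembly

open GPrepartition hiding mk
open DowlingLattice

variable {n r p m d : ℕ} {ξ ζ ω : ℂ}

theorem le_mk_of_zeroBlock_eq_univ {G : Type*} [Group G] {Q : GPrepartition G n}
    (hQ : Q.zeroBlock = Finset.univ) (x : DowlingLattice G n) : x ≤ mk Q := by
  obtain ⟨P, rfl⟩ := mk_surjective x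
  exact mk_le_mk.2 ⟨hQ ▸ Finset.subset_univ _, fun B _ => Or.inl (hQ ▸ Finset.subset_univ B)⟩

theorem exists_zeroBlock_eq_univ (G : Type*) (n : ℕ) [Inhabited G] :
    ∃ P : GPrepartition G n, P.zeroBlock = Finset.univ ∧ P.partition.parts = ∅ := by
  obtain ⟨P, hP, -, hB⟩ := exists_of_setoid (Finset.univ : Finset (Fin n)) ⊤
    fun _ => (default : G)
  refine ⟨P, hP, Finset.eq_empty_of_forall_notMem fun B hBP => ?_⟩
  obtain ⟨a, ha, -⟩ := (hB B).1 hBP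
  exact ha (Finset.mem_univ a)

/-- A description of the eigenspaces of a coset by prepartitions that satisfy a condition `C`. -/
theorem eigenspace_iff_of_condition (hn : 0 < n) (hr : 0 < r) (hm : 0 < m)
    (hd : d = m / Nat.gcd m r) (hξ : ξ ^ r = 1) (hζ : IsPrimitiveRoot ζ m)
    (hω : IsPrimitiveRoot ω (d * r)) {χ : Multiplicative (ZMod (d * r)) →* ℂˣ}
    (hχ : ∀ g, (χ g : ℂ) = ω ^ (Multiplicative.toAdd g).val)
    (hχs : ∀ z : ℂ, z ^ (d * r) = 1 → ∃ g, (χ g : ℂ) = z)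
    {F : DowlingLattice (Multiplicative (ZMod (d * r))) n ↪o (Submodule ℂ (Fin n → ℂ))ᵒᵈ}
    (hF : ∀ P, F (mk P) = OrderDual.toDual (P.subspace χ))
    {C : GPrepartition (Multiplicative (ZMod (d * r))) n → Prop}
    (hC : ∀ P : GPrepartition (Multiplicative (ZMod (d * r))) n,
      ∀ (θ : Fin n → ℂˣ) (σ : Equiv.Perm (Fin n)), (∀ i, θ i ^ r = 1) →
      (∏ i, (θ i : ℂ)) ^ (r / p) = ξ ^ (r / p) →
      P.subspace χ = Module.End.eigenspace (Matrix.toLin' (monomialMatrix θ σ)) ζ →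
      (∃ v ∈ Module.End.eigenspace (Matrix.toLin' (monomialMatrix θ σ)) ζ,
        ∀ a, v a = 0 ↔ a ∈ P.zeroBlock) → C P)
    (hC' : ∀ P : GPrepartition (Multiplicative (ZMod (d * r))) n, P.IsEvenlyColoured d → C P →
      ∃ t : ℂ, t ^ r = 1 ∧ t ^ (r / p) = ξ ^ (r / p) ∧
        ((P.zeroBlock = ∅ ∧ t = ζ ^ n) ∨ (P.zeroBlock.Nonempty ∧ t ≠ ζ ^ n) ∨
        (1 < P.zeroBlock.card ∧ t = ζ ^ n ∧ ∃ c : ℂ, c ^ r = 1 ∧ c ≠ ζ)))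
    (W : Submodule ℂ (Fin n → ℂ)) :
    (∃ x ∈ matrixCoset (diagFirst n ξ) (imprimitiveGroup r p n),
      W = Module.End.eigenspace (Matrix.toLin' x) ζ) ↔
    ∃ a ∈ {x | ∃ P, mk P = x ∧ P.IsEvenlyColoured d ∧ C P}, F a = OrderDual.toDual W := by
  constructor
  · rintro ⟨x, hx, rfl⟩
    obtain ⟨θ, σ, h1, h2, rfl⟩ := (mem_matrixCoset_diagFirst hn hr hξ).1 hx
    obtain ⟨P, hP, hPW, hv⟩ := exists_subspace_eq_eigenspace hr hm hd hζ hω hχ hχs σ h1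
    exact ⟨mk P, ⟨P, rfl, hP, hC P θ σ h1 h2 hPW hv⟩, (hF P).trans (congrArg _ hPW)⟩
  · rintro ⟨_, ⟨P, rfl, hP, hCP⟩, hPW⟩
    obtain ⟨t, h1, h2, h3⟩ := hC' P hP hCP
    obtain ⟨x, hx, hPx⟩ := hP.exists_mem_coset hn hr hm hd hξ hζ hω hχ h1 h2 h3
    rw [hF] at hPW
    exact ⟨x, hx, (OrderDual.toDual.injective hPW).symm.trans hPx⟩

variable {F : DowlingLattice (Multiplicative (ZMod (d * r))) n ↪o (Submodule ℂ (Fin n → ℂ))ᵒᵈ}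
  {C : GPrepartition (Multiplicative (ZMod (d * r))) n → Prop}

theorem exists_isTop_of_condition
    (hT : ∀ W, (∃ x ∈ matrixCoset (diagFirst n ξ) (imprimitiveGroup r p n),
      W = Module.End.eigenspace (Matrix.toLin' x) ζ) ↔
      ∃ a ∈ {x | ∃ P, mk P = x ∧ P.IsEvenlyColoured d ∧ C P}, F a = OrderDual.toDual W)
    (htop : ∀ P, P.zeroBlock = Finset.univ → C P) :
    ∃ x : EigenspacePoset (matrixCoset (diagFirst n ξ) (imprimitiveGroup r p n)) ζ, IsTop x := by
  obtain ⟨P, hP, hPe⟩ := exists_zeroBlock_eq_univ (Multiplicative (ZMod (d * r))) n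
  exact exists_isTop_eigenspacePoset F hT
    (t := mk P) ⟨P, rfl, fun B hB => absurd hB (hPe ▸ Finset.notMem_empty B), htop P hP⟩
    fun a _ => le_mk_of_zeroBlock_eq_univ hP a

/-- The two alternatives in `hbot` control a least element. In the first, `zeroHat` itself is
realised and is therefore the least one. In the second, `not_forall_eigenspace_le` forces a least
element to be the zero space, which is also the greatest. -/
theorem nonempty_hat_orderIso_of_condition (hn : 1 < n) (hr : 0 < r) (hm : 0 < m)
    (hd : d = m / Nat.gcd m r) (hξ : ξ ^ r = 1) (hω : IsPrimitiveRoot ω (d * r))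
    {χ : Multiplicative (ZMod (d * r)) →* ℂˣ} (hχi : Function.Injective χ)
    (hF : ∀ P, F (mk P) = OrderDual.toDual (P.subspace χ))
    (hT : ∀ W, (∃ x ∈ matrixCoset (diagFirst n ξ) (imprimitiveGroup r p n),
      W = Module.End.eigenspace (Matrix.toLin' x) ζ) ↔
      ∃ a ∈ {x | ∃ P, mk P = x ∧ P.IsEvenlyColoured d ∧ C P}, F a = OrderDual.toDual W)
    (htop : ∀ P, P.zeroBlock = Finset.univ → C P)
    (hbot : (d = 1 ∧ ∀ P, P.zeroBlock = ∅ → C P) ∨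
      (∀ P, C P → P.zeroBlock.Nonempty ∨ 1 < d) ∧ ¬ (n = 2 ∧ r = 1 ∧ m = 2)) :
    Nonempty (AdjoinBounds (ProperPart (EigenspacePoset
      (matrixCoset (diagFirst n ξ) (imprimitiveGroup r p n)) ζ)) ≃o
      {x : QDowling n (d * r) // x = zeroHat ∨ ∃ P, mk P = x ∧ P.IsEvenlyColoured d ∧ C P}) := by
  obtain ⟨Q, hQ, hQe⟩ := exists_zeroBlock_eq_univ (Multiplicative (ZMod (d * r))) n
  refine nonempty_hat_eigenspacePoset_orderIso F hT
    (t := mk Q) ⟨Q, rfl, fun B hB => absurd hB (hQe ▸ Finset.notMem_empty B), htop Q hQ⟩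
    (fun a _ => le_mk_of_zeroBlock_eq_univ hQ a) (b := zeroHat) zeroHat_le ?_ ?_
  · intro h
    have h' := (mk_eq_mk.1 h).1
    rw [hQ] at h'
    have h2 := congrArg Finset.card h'
    rw [Finset.card_univ, Fintype.card_fin] at h2
    exact absurd (h2.trans Finset.card_empty) (by omega)
  · rintro _ ⟨P, rfl, hP, hCP⟩ hle
    rcases hbot with ⟨hd1, h0⟩ | ⟨h1, hex⟩
    · refine Or.inr (le_antisymm (hle _ ⟨_, rfl, fun B _ i j => ?_, h0 _ rfl⟩) (zeroHat_le _))
      simp only [hd1, Nat.modEq_one]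
    · refine Or.inl (le_antisymm (le_mk_of_zeroBlock_eq_univ hQ _) ?_)
      by_cases hPu : P.zeroBlock = Finset.univ
      · exact le_mk_of_zeroBlock_eq_univ hPu _
      · refine absurd (fun x hx => ?_) (hP.not_forall_eigenspace_le (p := p) (ζ := ζ) hn hr hm hd
          hξ hω hχi ((hT _).2 ⟨mk P, ⟨P, rfl, hP, hCP⟩, hF P⟩) hPu (h1 P hCP) hex)
        obtain ⟨a, ha, haF⟩ := (hT _).1 ⟨x, hx, rfl⟩
        have h := F.le_iff_le.2 (hle a ha)
        rw [hF, haF] at h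
        exact h

end Assembly

/-! ### The four cases. -/

section Cases

open GPrepartition hiding mk
open DowlingLattice

variable {n r p m d : ℕ} {ξ ζ ω : ℂ}

theorem nonempty_orderIso_subtype_congr {α β : Type*} [PartialOrder α] [PartialOrder β]
    {q q' : β → Prop} (h : Nonempty (α ≃o {x // q x})) (hq : ∀ x, q x ↔ q' x) :
    Nonempty (α ≃o {x // q' x}) := by
  obtain rfl : q = q' := funext fun x => propext (hq x)
  exact h

theorem pow_pow_eq_one_iff_dvd (hr : 0 < r) (hd : d = m / Nat.gcd m r)
    (hζ : IsPrimitiveRoot ζ m) (k : ℕ) : (ζ ^ k) ^ r = 1 ↔ d ∣ k := by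
  have hζr : IsPrimitiveRoot (ζ ^ r) d := hζ.pow_of_div_gcd hr hd
  rw [pow_right_comm]
  exact hζr.pow_eq_one_iff_dvd k

theorem pow_eq_pow_iff_mul_inv (hξ : ξ ≠ 0) (k : ℕ) {z : ℂ} :
    (z * ξ⁻¹) ^ k = 1 ↔ z ^ k = ξ ^ k := by
  rw [mul_pow, inv_pow, mul_inv_eq_one₀ (pow_ne_zero k hξ)]

/-- An empty zero block would make the product of the entries `ζ ^ n`, which the coset forbids. For
a nonempty one the product `ξ` is admissible, as it differs from `ζ ^ n`. -/
theorem hat_orderIso_of_pow_ne (hn : 1 < n) (hr : 0 < r) (hm : 0 < m)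
    (hd : d = m / Nat.gcd m r) (hξ : ξ ^ r = 1) (hζ : IsPrimitiveRoot ζ m)
    (hω : IsPrimitiveRoot ω (d * r)) (hnd : d ∣ n)
    (h : (ζ ^ n) ^ (r / p) ≠ ξ ^ (r / p)) :
    (∃ x : EigenspacePoset (matrixCoset (diagFirst n ξ) (imprimitiveGroup r p n)) ζ, IsTop x) ∧
    Nonempty (AdjoinBounds (ProperPart (EigenspacePoset
      (matrixCoset (diagFirst n ξ) (imprimitiveGroup r p n)) ζ)) ≃o
      QDowlingEvenAvoid n (d * r) d d {0}) := by
  have hd0 : 0 < d := div_gcd_pos hm hd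
  have : NeZero (d * r) := ⟨(Nat.mul_pos hd0 hr).ne'⟩
  obtain ⟨χ, hχi, hχ, hχs⟩ := hω.exists_character
  obtain ⟨F, hF⟩ := exists_orderEmbedding (n := n) hχi
  have hT := eigenspace_iff_of_condition (p := p) (by omega) hr hm hd hξ hζ hω hχ hχs hF
    (C := fun P => P.zeroBlock.card ∉ ({0} : Set ℕ))
    (fun P θ σ _ hθ _ ⟨v, hv, hv0⟩ h0 => h (by
      rw [Set.mem_singleton_iff, Finset.card_eq_zero] at h0
      have hv' : ∀ a ∈ Finset.univ, v a ≠ 0 := fun a _ => by simp [hv0, h0]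
      rw [← hθ, prod_eq_pow_of_eigenvector hv (by simp) hv', Finset.card_univ,
        Fintype.card_fin]))
    (fun P _ hP => ⟨ξ, hξ, rfl, Or.inr (Or.inl
      ⟨Finset.card_ne_zero.1 hP, fun h' => h (by rw [h'])⟩)⟩)
  have htop : ∀ P : GPrepartition (Multiplicative (ZMod (d * r))) n,
      P.zeroBlock = Finset.univ → P.zeroBlock.card ∉ ({0} : Set ℕ) := by
    intro P hP
    rw [hP, Finset.card_univ, Fintype.card_fin, Set.mem_singleton_iff]
    omega
  have hex : ¬ (n = 2 ∧ r = 1 ∧ m = 2) := by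
    rintro ⟨rfl, rfl, rfl⟩
    rw [pow_one] at hξ
    rw [hζ.pow_eq_one, hξ] at h
    exact h rfl
  refine ⟨exists_isTop_of_condition hT htop, nonempty_orderIso_subtype_congr
    (nonempty_hat_orderIso_of_condition hn hr hm hd hξ hω hχi hF hT htop
      (Or.inr ⟨fun P hP => Or.inl (Finset.card_ne_zero.1 hP), hex⟩)) fun x => ?_⟩
  exact or_congr_right (exists_congr fun P => and_congr_right fun _ =>
    ⟨fun hP => ⟨hP.1.isDivisible hd0, hP⟩, fun hP => hP.2⟩)

/-- As `r / p = 1`, the product of the entries must be `ξ = ζ ^ n`, which excludes a zero block of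
size one. An empty zero block is realised directly, a larger one by splitting it into two cycles. -/
theorem hat_orderIso_of_pow_eq {N : ℕ} (hN : N = d * r) (hrp : r / p = 1) (hn : 1 < n) (hr : 1 < r) (hm : 0 < m)
    (hd : d = m / Nat.gcd m r) (hξ : ξ ^ r = 1) (hζ : IsPrimitiveRoot ζ m)
    (hω : IsPrimitiveRoot ω (d * r)) (hd1 : d = 1) (h : ζ ^ n = ξ)
    (hc : ∃ c : ℂ, c ^ r = 1 ∧ c ≠ ζ) :
    (∃ x : EigenspacePoset (matrixCoset (diagFirst n ξ) (imprimitiveGroup r p n)) ζ, IsTop x) ∧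
    Nonempty (AdjoinBounds (ProperPart (EigenspacePoset
      (matrixCoset (diagFirst n ξ) (imprimitiveGroup r p n)) ζ)) ≃o
      QDowlingAvoid n N {1}) := by
  subst hN
  have hr0 : 0 < r := by omega
  have hd0 : 0 < d := div_gcd_pos hm hd
  have : NeZero (d * r) := ⟨(Nat.mul_pos hd0 hr0).ne'⟩
  have hζ0 : ζ ≠ 0 := hζ.ne_zero hm.ne'
  obtain ⟨χ, hχi, hχ, hχs⟩ := hω.exists_character
  obtain ⟨F, hF⟩ := exists_orderEmbedding (n := n) hχi
  have hT := eigenspace_iff_of_condition (p := p) (by omega) hr0 hm hd hξ hζ hω hχ hχs hF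
    (C := fun P => P.zeroBlock.card ∉ ({1} : Set ℕ))
    (fun P θ σ _ hθ hP ⟨v, hv, hv0⟩ h1 => by
      obtain ⟨a₀, ha₀⟩ := Finset.card_eq_one.1 (Set.mem_singleton_iff.1 h1)
      rw [hrp, pow_one, pow_one, ← h] at hθ
      obtain ⟨u, hu, hua⟩ := exists_eigenvector_apply_ne_zero hζ0 hv hθ (a₀ := a₀)
        fun a => by rw [hv0, ha₀, Finset.mem_singleton]
      rw [← hP] at hu
      exact hua (hu.1 a₀ (by rw [ha₀, Finset.mem_singleton])))
    (fun P _ hP => ⟨ξ, hξ, rfl, by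
      rcases Finset.eq_empty_or_nonempty P.zeroBlock with h0 | h0
      · exact Or.inl ⟨h0, h.symm⟩
      · have := Finset.card_pos.2 h0
        have h1 : P.zeroBlock.card ≠ 1 := hP
        exact Or.inr (Or.inr ⟨by omega, h.symm, hc⟩)⟩)
  have htop : ∀ P : GPrepartition (Multiplicative (ZMod (d * r))) n,
      P.zeroBlock = Finset.univ → P.zeroBlock.card ∉ ({1} : Set ℕ) := by
    intro P hP
    rw [hP, Finset.card_univ, Fintype.card_fin, Set.mem_singleton_iff]
    omega
  refine ⟨exists_isTop_of_condition hT htop, nonempty_orderIso_subtype_congr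
    (nonempty_hat_orderIso_of_condition hn hr0 hm hd hξ hω hχi hF hT htop
      (Or.inl ⟨hd1, fun P hP => by simp [hP]⟩)) fun x => ?_⟩
  refine or_congr_right (exists_congr fun P => and_congr_right fun _ =>
    ⟨fun hP => hP.2, fun hP => ⟨fun B _ i j => ?_, hP⟩⟩)
  simp only [hd1, Nat.modEq_one]

/-- Under `h0` and `h1` no size of the zero block is excluded, because a suitable product `t` always
exists. -/
theorem hat_orderIso_of_forall (hn : 1 < n) (hr : 0 < r) (hm : 0 < m)
    (hd : d = m / Nat.gcd m r) (hξ : ξ ^ r = 1) (hζ : IsPrimitiveRoot ζ m)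
    (hω : IsPrimitiveRoot ω (d * r))
    (h0 : d ∣ n → (ζ ^ n) ^ (r / p) = ξ ^ (r / p))
    (h1 : ξ = ζ ^ n → d ≠ 1 ∨ ∃ t : ℂ, t ^ r = 1 ∧ t ^ (r / p) = ξ ^ (r / p) ∧ t ≠ ζ ^ n) :
    (∃ x : EigenspacePoset (matrixCoset (diagFirst n ξ) (imprimitiveGroup r p n)) ζ, IsTop x) ∧
    (¬ (n = 2 ∧ r = 1 ∧ m = 2) → Nonempty (AdjoinBounds (ProperPart (EigenspacePoset
      (matrixCoset (diagFirst n ξ) (imprimitiveGroup r p n)) ζ)) ≃o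
      QDowlingEven n (d * r) d d)) := by
  have hd0 : 0 < d := div_gcd_pos hm hd
  have : NeZero (d * r) := ⟨(Nat.mul_pos hd0 hr).ne'⟩
  obtain ⟨χ, hχi, hχ, hχs⟩ := hω.exists_character
  obtain ⟨F, hF⟩ := exists_orderEmbedding (n := n) hχi
  have hT := eigenspace_iff_of_condition (p := p) (by omega) hr hm hd hξ hζ hω hχ hχs hF
    (C := fun _ => True) (fun _ _ _ _ _ _ _ => trivial) (fun P hP _ => by
      have hdvd := (hP.isDivisible hd0).dvd_sub_card
      have hle : P.zeroBlock.card ≤ n := by simpa using Finset.card_le_univ P.zeroBlock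
      rcases Finset.eq_empty_or_nonempty P.zeroBlock with he | hI
      · rw [he, Finset.card_empty, Nat.sub_zero] at hdvd
        exact ⟨ζ ^ n, (pow_pow_eq_one_iff_dvd hr hd hζ n).2 hdvd, h0 hdvd, Or.inl ⟨he, rfl⟩⟩
      by_cases hξn : ξ = ζ ^ n
      · rcases h1 hξn with hd1 | ⟨t, ht1, ht2, ht3⟩
        -- Since `d` divides both `n` and `n - |I|`, it divides `|I|`, so `|I| ≥ d > 1` and two
        -- cycles fit. The choice `c = 1` works because `ζ = 1` would give `d = 1`.
        · refine ⟨ξ, hξ, rfl, Or.inr (Or.inr ⟨?_, hξn, 1, one_pow r, ?_⟩)⟩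
          · have hdn : d ∣ n := (pow_pow_eq_one_iff_dvd hr hd hζ n).1 (hξn ▸ hξ)
            have := Nat.le_of_dvd (Finset.card_pos.2 hI) ((Nat.dvd_sub_iff_right hle hdn).1 hdvd)
            omega
          · rintro rfl
            have hm1 : m = 1 := Nat.dvd_one.1 (hζ.dvd_of_pow_eq_one 1 (one_pow 1))
            exact hd1 (by rw [hd, hm1, Nat.gcd_one_left, Nat.div_one])
        · exact ⟨t, ht1, ht2, Or.inr (Or.inl ⟨hI, ht3⟩)⟩
      · exact ⟨ξ, hξ, rfl, Or.inr (Or.inl ⟨hI, hξn⟩)⟩)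
  refine ⟨exists_isTop_of_condition hT fun _ _ => trivial,
    fun hex => nonempty_orderIso_subtype_congr (nonempty_hat_orderIso_of_condition hn hr hm hd hξ
      hω hχi hF hT (fun _ _ => trivial) ?_) fun x => ?_⟩
  · rcases Nat.lt_or_ge 1 d with hd1 | hd1
    · exact Or.inr ⟨fun _ _ => Or.inr hd1, hex⟩
    · exact Or.inl ⟨by omega, fun _ _ => trivial⟩
  · exact or_congr_right (exists_congr fun P => and_congr_right fun _ =>
      ⟨fun hP => ⟨hP.1.isDivisible hd0, hP.1⟩, fun hP => ⟨hP.2, trivial⟩⟩)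

/-- The case of the symmetric group. -/
theorem hat_orderIso_partitionLattice (hn : 1 < n) :
    (∃ x : EigenspacePoset (matrixCoset (diagFirst n 1) (imprimitiveGroup 1 1 n)) 1, IsTop x) ∧
    Nonempty (AdjoinBounds (ProperPart (EigenspacePoset
      (matrixCoset (diagFirst n 1) (imprimitiveGroup 1 1 n)) 1)) ≃o PartitionLattice n) := by
  classical
  have : NeZero (1 * 1) := ⟨by norm_num⟩
  have : Subsingleton (Multiplicative (ZMod (1 * 1))) :=
    inferInstanceAs (Subsingleton (Multiplicative (Fin 1)))
  have hω : IsPrimitiveRoot (1 : ℂ) (1 * 1) := IsPrimitiveRoot.one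
  obtain ⟨χ, hχi, hχ, hχs⟩ := hω.exists_character
  obtain ⟨F, hF⟩ := exists_orderEmbedding (n := n) hχi
  obtain ⟨J, hJ⟩ := exists_partitionLattice_orderEmbedding
    (Multiplicative (ZMod (1 * 1))) n
  have hT := eigenspace_iff_of_condition (ξ := 1) (p := 1) (by omega) one_pos one_pos (d := 1) (by simp)
    (one_pow 1) IsPrimitiveRoot.one hω hχ hχs hF (C := fun P => P.zeroBlock = ∅)
    (fun P θ σ hθ _ hP _ => by
      -- Permutation matrices fix the all-ones vector, so no coordinate vanishes on the eigenspace.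
      -- The greatest element is thus the line of constant vectors, not the zero space.
      have h1 : (fun _ => 1) ∈ P.subspace χ := by
        rw [hP, mem_eigenspace_monomialMatrix]
        intro a
        rw [← pow_one (θ (σ a)), hθ, Units.val_one]
      exact Finset.eq_empty_of_forall_notMem fun a ha => one_ne_zero (h1.1 a ha))
    (fun P _ hP => ⟨1, one_pow _, rfl, Or.inl ⟨hP, (one_pow n).symm⟩⟩)
  have hT' : ∀ W, (∃ x ∈ matrixCoset (diagFirst n 1) (imprimitiveGroup 1 1 n),
      W = Module.End.eigenspace (Matrix.toLin' x) 1) ↔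
      ∃ π ∈ (Set.univ : Set (PartitionLattice n)), (J.trans F) π = OrderDual.toDual W := by
    intro W
    rw [hT W]
    constructor
    · rintro ⟨_, ⟨P, rfl, -, hP⟩, hW⟩
      obtain ⟨π, hπ⟩ := (hJ P).2 hP
      exact ⟨π, Set.mem_univ π, (congrArg F hπ).trans hW⟩
    · rintro ⟨π, -, hW⟩
      obtain ⟨P, hP⟩ := mk_surjective (J π)
      refine ⟨J π, ⟨P, hP, fun B _ i j => ?_, (hJ P).1 ⟨π, hP.symm⟩⟩, hW⟩
      simp only [Nat.modEq_one]
  have htop : ∀ π : PartitionLattice n, π ≤ ⊤ := fun π => le_top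
  have hne : (⊤ : PartitionLattice n) ≠ ⊥ := by
    intro h
    have h1 := Finset.card_le_card (Finpartition.parts_top_subset (Finset.univ : Finset (Fin n)))
    rw [h, Finpartition.card_bot, Finset.card_singleton, Finset.card_univ, Fintype.card_fin] at h1
    omega
  refine ⟨exists_isTop_eigenspacePoset (J.trans F) hT' (Set.mem_univ ⊤) fun π _ => htop π, ?_⟩
  obtain ⟨e⟩ := nonempty_hat_eigenspacePoset_orderIso (J.trans F) hT' (Set.mem_univ ⊤)
    (fun π _ => htop π) (b := ⊥) (fun _ => bot_le) hne
    fun π _ h => Or.inr (le_bot_iff.1 (h ⊥ (Set.mem_univ _)))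
  refine ⟨e.trans ⟨⟨Subtype.val, fun π => ⟨π, Or.inr (Set.mem_univ π)⟩, fun _ => rfl,
    fun _ => rfl⟩, Iff.rfl⟩⟩

end Cases

/-! ### The main theorem. -/

theorem mainTheorem6
    (r p n e m d : ℕ) (hr : 0 < r) (hpr : p ∣ r) (hep : e ∣ p) (hm : 0 < m) (hn : 1 < n)
    (hd : d = m / Nat.gcd m r)
    (ξ : ℕ → ℂ) (hξ : ∀ k, 0 < k → IsPrimitiveRoot (ξ k) k)
    (ζ : ℂ) (hζ : IsPrimitiveRoot ζ m)
    (X : Set (Matrix (Fin n) (Fin n) ℂ))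
    (hX : X = matrixCoset (diagFirst n (ξ (e * r / p))) (imprimitiveGroup r p n)) :
    -- the greatest element that is removed does exist
    (∃ x : EigenspacePoset X ζ, IsTop x) ∧
    -- (i)
    (n ≡ 0 [MOD d] → (ζ ^ n * (ξ (e * r / p))⁻¹) ^ (r / p) ≠ 1 →
      Nonempty (AdjoinBounds (ProperPart (EigenspacePoset X ζ)) ≃o
        QDowlingEvenAvoid n (d * r) d d {0})) ∧
    -- (ii)
    (d = 1 → r = p → r ≠ 1 → ζ ^ n = ξ e →
      Nonempty (AdjoinBounds (ProperPart (EigenspacePoset X ζ)) ≃o QDowlingAvoid n r {1})) ∧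
    -- (iii)
    (d = 1 → r = 1 → p = 1 →
      m = 1 ∧
      Nonempty (AdjoinBounds (ProperPart (EigenspacePoset X ζ)) ≃o QDowling (n - 1) 1) ∧
      Nonempty (QDowling (n - 1) 1 ≃o PartitionLattice n)) ∧
    -- (iv)
    (¬ (n ≡ 0 [MOD d] ∧ (ζ ^ n * (ξ (e * r / p))⁻¹) ^ (r / p) ≠ 1) →
      ¬ (d = 1 ∧ r = p ∧ r ≠ 1 ∧ ζ ^ n = ξ e) →
      ¬ (d = 1 ∧ r = 1 ∧ p = 1) →
      ¬ (n = 2 ∧ r = 1 ∧ m = 2) →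
      Nonempty (AdjoinBounds (ProperPart (EigenspacePoset X ζ)) ≃o
        QDowlingEven n (d * r) d d)) := by
  subst hX
  have hp : 0 < p := Nat.pos_of_dvd_of_pos hpr hr
  have he : 0 < e := Nat.pos_of_dvd_of_pos hep hp
  have hd0 : 0 < d := div_gcd_pos hm hd
  obtain ⟨q, rfl⟩ := hpr
  have hq : 0 < q := Nat.pos_of_mul_pos_left hr
  have hrp : p * q / p = q := Nat.mul_div_cancel_left q hp
  have heq : e * (p * q) / p = e * q := by rw [mul_left_comm, Nat.mul_div_cancel_left _ hp]
  rw [heq, hrp]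
  have hξr : ξ (e * q) ^ (p * q) = 1 :=
    ((hξ _ (Nat.mul_pos he hq)).pow_eq_one_iff_dvd _).2 (Nat.mul_dvd_mul_right hep q)
  have hω : IsPrimitiveRoot (ξ (d * (p * q))) (d * (p * q)) := hξ _ (Nat.mul_pos hd0 hr)
  have hne : (ζ ^ n * (ξ (e * q))⁻¹) ^ q ≠ 1 ↔ (ζ ^ n) ^ q ≠ ξ (e * q) ^ q :=
    (pow_eq_pow_iff_mul_inv (ne_zero_of_pow_eq_one_of_pos hr hξr) q).not
  rw [hne, Nat.modEq_zero_iff_dvd]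
  have ofPowNe := fun h1 h2 => hat_orderIso_of_pow_ne (p := p) hn hr hm hd hξr hζ hω h1
    (hrp.symm ▸ h2)
  have ofPowEq : d = 1 → p * q = p → p * q ≠ 1 → ζ ^ n = ξ e →
      (∃ x : EigenspacePoset (matrixCoset (diagFirst n (ξ (e * q)))
        (imprimitiveGroup (p * q) p n)) ζ, IsTop x) ∧
      Nonempty (AdjoinBounds (ProperPart (EigenspacePoset (matrixCoset (diagFirst n (ξ (e * q)))
        (imprimitiveGroup (p * q) p n)) ζ)) ≃o QDowlingAvoid n (p * q) {1}) := by
    intro hd1 hpq hr1 hζn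
    obtain rfl : q = 1 := by
      rwa [Nat.mul_eq_left hp.ne'] at hpq
    rw [← mul_one e] at hζn
    -- As `r > 1`, there are at least two `r`-th roots of unity to choose from.
    have hc : ∃ c : ℂ, c ^ (p * 1) = 1 ∧ c ≠ ζ := by
      by_cases hζ1 : ζ = 1
      · exact ⟨ξ (p * 1), (hξ _ hr).pow_eq_one,
          hζ1 ▸ (hξ _ hr).ne_one (by omega)⟩
      · exact ⟨1, one_pow _, fun h => hζ1 h.symm⟩
    exact hat_orderIso_of_pow_eq (by rw [hd1, one_mul]) hrp hn (by omega) hm hd hξr hζ hω hd1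
      hζn hc
  have ofTrivial : d = 1 → p * q = 1 → p = 1 → m = 1 ∧
      (∃ x : EigenspacePoset (matrixCoset (diagFirst n (ξ (e * q)))
        (imprimitiveGroup (p * q) p n)) ζ, IsTop x) ∧
      Nonempty (AdjoinBounds (ProperPart (EigenspacePoset (matrixCoset (diagFirst n (ξ (e * q)))
        (imprimitiveGroup (p * q) p n)) ζ)) ≃o PartitionLattice n) := by
    rintro rfl hpq rfl
    obtain rfl : q = 1 := by simpa using hpq
    obtain rfl : e = 1 := Nat.dvd_one.1 hep
    obtain rfl : m = 1 := by simpa using hd.symm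
    obtain rfl : ζ = 1 := IsPrimitiveRoot.one_right_iff.1 hζ
    have h1 : ξ (1 * 1) = 1 := IsPrimitiveRoot.one_right_iff.1 (hξ 1 one_pos)
    rw [h1]
    exact ⟨rfl, hat_orderIso_partitionLattice hn⟩
  have ofForall : ¬ (d ∣ n ∧ (ζ ^ n) ^ q ≠ ξ (e * q) ^ q) →
      ¬ (d = 1 ∧ p * q = p ∧ p * q ≠ 1 ∧ ζ ^ n = ξ e) → ¬ (d = 1 ∧ p * q = 1 ∧ p = 1) →
      (∃ x : EigenspacePoset (matrixCoset (diagFirst n (ξ (e * q)))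
        (imprimitiveGroup (p * q) p n)) ζ, IsTop x) ∧
      (¬ (n = 2 ∧ p * q = 1 ∧ m = 2) →
      Nonempty (AdjoinBounds (ProperPart (EigenspacePoset (matrixCoset (diagFirst n (ξ (e * q)))
        (imprimitiveGroup (p * q) p n)) ζ)) ≃o QDowlingEven n (d * (p * q)) d d)) := by
    intro h1 h2 h3
    refine hat_orderIso_of_forall hn hr hm hd hξr hζ hω (fun hdn => ?_) fun hξn => ?_
    · rw [hrp]
      by_contra h
      exact h1 ⟨hdn, h⟩
    · by_cases hq1 : q = 1
      · subst hq1
        rw [mul_one] at hξn h2 h3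
        refine Or.inl fun hd1 => ?_
        by_cases hp1 : p = 1
        · exact h3 ⟨hd1, hp1, hp1⟩
        · exact h2 ⟨hd1, rfl, hp1, hξn.symm⟩
      -- For `q = r / p > 1` the coset admits several products; multiplying by a primitive `q`-th
      -- root of unity gives one different from `ζ ^ n`.
      · refine Or.inr ⟨ξ (e * q) * ξ q, ?_, ?_, fun h => ?_⟩
        · rw [mul_pow, hξr, one_mul, mul_comm, pow_mul, (hξ q hq).pow_eq_one, one_pow]
        · rw [hrp, mul_pow, (hξ q hq).pow_eq_one, mul_one]
        · rw [← hξn] at h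
          exact (hξ q hq).ne_one (by omega)
            ((mul_eq_left₀ (ne_zero_of_pow_eq_one_of_pos hr hξr)).1 h)
  refine ⟨?_, fun h1 h2 => (ofPowNe h1 h2).2, fun h1 h2 h3 h4 => (ofPowEq h1 h2 h3 h4).2, ?_, ?_⟩
  · by_cases h1 : d ∣ n ∧ (ζ ^ n) ^ q ≠ ξ (e * q) ^ q
    · exact (ofPowNe h1.1 h1.2).1
    by_cases h2 : d = 1 ∧ p * q = p ∧ p * q ≠ 1 ∧ ζ ^ n = ξ e
    · exact (ofPowEq h2.1 h2.2.1 h2.2.2.1 h2.2.2.2).1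
    by_cases h3 : d = 1 ∧ p * q = 1 ∧ p = 1
    · exact (ofTrivial h3.1 h3.2.1 h3.2.2).2.1
    · exact (ofForall h1 h2 h3).1
  · intro h1 h2 h3
    obtain ⟨hm1, -, ⟨f⟩⟩ := ofTrivial h1 h2 h3
    obtain ⟨k, rfl⟩ : ∃ k, n = k + 1 := ⟨n - 1, by omega⟩
    have : Subsingleton (Multiplicative (ZMod 1)) :=
      inferInstanceAs (Subsingleton (Multiplicative (Fin 1)))
    obtain ⟨g⟩ := nonempty_dowlingLattice_orderIso_partitionLattice
      (G := Multiplicative (ZMod 1)) k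
    exact ⟨hm1, ⟨f.trans g.symm⟩, ⟨g⟩⟩
  · exact fun h1 h2 h3 h4 => (ofForall h1 h2 h3).2 h4
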